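/- Let $p:\mathcal X\to Y$ be a proper holomorphic map between complex manifolds (Hausdorff and second countable) with $\dim_{\mathbb C} Y=m$ and $\dim_{\mathbb C}\mathcal X=n+m$, whose differential $dp$ is surjective at every point; write $\mathcal X_t=p^{-1}(t)$ for $t\in Y$. Let $L\to\mathcal X$ be a holomorphic line bundle with a smooth Hermitian metric $h$. Locally write $h=e^{-\phi}$ in a holomorphic frame, and let $\Theta=i\sum_{j,k}\phi_{j\bar k}\,dz_j\wedge d\bar z_k$, with $\phi_{j\bar k}=\partial^2\phi/\partial z_j\partial\bar z_k$, be the curvature of $h$; put $\Theta(u,\bar u)=\sum_{j,k}\phi_{j\bar k}u_j\bar u_k$ for a holomorphic tangent vector $u=\sum_j u_j\,\partial/\partial z_j$. Assume that $\Theta$ is uniformly weakly RC-positive, that is: 1. $\Theta$ is positive on every fibre $\mathcal X_t$, i.e. $\Theta(u,\bar u)>0$ for every nonzero tangent vector $u$ of $\mathcal X$ with $dp(u)=0$; and 2. for every $t\in Y$ there is a nonzero $v\in T_tY$ such that $\Theta(\tilde v,\bar{\tilde v})>0$ for every $x\in\mathcal X_t$ and every lift $\tilde v\in T_x\mathcal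 X$ of $v$ (i.e. every $\tilde v\in T_x\mathcal X$ with $dp_x(\tilde v)=v$). Then there exists a smooth Hermitian metric $\alpha$ on $Y$ (identified with its $(1,1)$-form $i\sum_{j,k}\alpha_{j\bar k}\,dt_j\wedge d\bar t_k$) such that $$\Theta^{n+1}\wedge p^*\alpha^{m-1}>0$$ at every point of $\mathcal X$; that is, this $(n+m,n+m)$-form is everywhere a positive multiple of the volume form $\bigwedge_{k=1}^{n+m} i\,dz_k\wedge d\bar z_k$. (If $m=0$, condition 2 forces $Y=\emptyset$, and nothing is claimed.) -/

import Mathlib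

open scoped Manifold ContDiff Bundle
open Bundle Complex

noncomputable section

/-! ### Exterior algebra of the complexified cotangent space of `ℂ^d` -/

/-- The model space `ℂ^d`. -/
abbrev Cn (d : ℕ) : Type := EuclideanSpace ℂ (Fin d)

/-- The `j`-th vector of the standard basis of `ℂ^d`. -/
def stdVec {d : ℕ} (j : Fin d) : Cn d := EuclideanSpace.single j (1 : ℂ)

/-- The complexified real cotangent space `Hom_ℝ(ℂ^d, ℂ) = T^* ⊗_ℝ ℂ`, with `ℂ` acting on values. -/
abbrev CplxCotangent (d : ℕ) : Type := Cn d →ₗ[ℝ] ℂ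

/-- The algebra `Λ^• (T^* ⊗_ℝ ℂ)` of complex-valued exterior forms at a point; its product is the
wedge product. -/
abbrev ExtForms (d : ℕ) : Type := ExteriorAlgebra ℂ (CplxCotangent d)

/-- The covector `dz_k`. -/
def dz {d : ℕ} (k : Fin d) : CplxCotangent d where
  toFun u := u k
  map_add' _ _ := rfl
  map_smul' _ _ := rfl

/-- The covector `dz̄_k`. -/
def dzbar {d : ℕ} (k : Fin d) : CplxCotangent d where
  toFun u := (starRingEnd ℂ) (u k)
  map_add' u v := by simp
  map_smul' c u := by simp

/-- The two-form `dz_j ∧ dz̄_k`. -/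
def dzdzbar {d : ℕ} (j k : Fin d) : ExtForms d :=
  ExteriorAlgebra.ι ℂ (dz j) * ExteriorAlgebra.ι ℂ (dzbar k)

/-- Sesquilinear forms on a complex vector space, linear in the first variable and conjugate linear
in the second one. -/
abbrev Sesq (V : Type*) [AddCommGroup V] [Module ℂ V] : Type _ :=
  V →ₗ[ℂ] V →ₗ⋆[ℂ] ℂ

/-- The `(1,1)`-form `i ∑_{j,k} H_{j k̄} dz_j ∧ dz̄_k`, `H_{j k̄} = H(e_j, e_k)`, of a sesquilinear
form `H`. -/
def form11 {d : ℕ} (H : Sesq (Cn d)) : ExtForms d :=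
  ∑ j, ∑ k, (I * H (stdVec j) (stdVec k)) • dzdzbar j k

/-- The positive volume form `(i dz_1 ∧ dz̄_1) ∧ … ∧ (i dz_d ∧ dz̄_d)`. -/
def volForm (d : ℕ) : ExtForms d :=
  (List.ofFn fun k : Fin d => I • dzdzbar k k).prod

/-- A form is a positive top-degree form if it is a positive multiple of the volume form. -/
def IsPositiveTop {d : ℕ} (τ : ExtForms d) : Prop :=
  ∃ c : ℝ, 0 < c ∧ τ = (c : ℂ) • volForm d

/-- Precomposition of covectors with a complex linear map. -/
def pullbackCovector {d d' : ℕ} (A : Cn d →ₗ[ℂ] Cn d') :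
    CplxCotangent d' →ₗ[ℂ] CplxCotangent d where
  toFun g := g ∘ₗ A.restrictScalars ℝ
  map_add' _ _ := rfl
  map_smul' _ _ := rfl

/-- Pullback of exterior forms under a complex linear map. -/
def pullbackForm {d d' : ℕ} (A : Cn d →ₗ[ℂ] Cn d') : ExtForms d' →ₐ[ℂ] ExtForms d :=
  ExteriorAlgebra.map (pullbackCovector A)

/-! ### The complex Hessian -/

/-- For real-valued `φ`, the number `∑_{j,k} φ_{j k̄}(a) u_j v̄_k`, where
`φ_{j k̄} = ∂²φ/∂z_j∂z̄_k`, `∂/∂z_j = (∂/∂x_j - i ∂/∂y_j)/2` and `∂/∂z̄_k = (∂/∂x_k + i ∂/∂y_k)/2`. -/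
def leviFun {d : ℕ} (φ : Cn d → ℝ) (a u v : Cn d) : ℂ :=
  let D : Cn d → Cn d → ℝ := fun u v => fderiv ℝ (fderiv ℝ φ) a u v
  ((D u v + D (I • u) (I • v) : ℝ) + I * (D u (I • v) - D (I • u) v : ℝ)) / 4

theorem smul_eq_re_im {d : ℕ} (c : ℂ) (w : Cn d) : c • w = c.re • w + c.im • (I • w) := by
  ext i
  simp only [PiLp.smul_apply, PiLp.add_apply, smul_eq_mul, real_smul]
  nth_rw 1 [← re_add_im c]
  ring

theorem I_smul_smul_eq {d : ℕ} (c : ℂ) (w : Cn d) :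
    I • (c • w) = c.re • (I • w) - c.im • w := by
  ext i
  simp only [PiLp.smul_apply, PiLp.sub_apply, smul_eq_mul, real_smul]
  nth_rw 1 [← re_add_im c]
  linear_combination (c.im : ℂ) * w i * I_mul_I

/-- The complex Hessian of `φ` at `a`, as a sesquilinear form. -/
def leviForm {d : ℕ} (φ : Cn d → ℝ) (a : Cn d) : Sesq (Cn d) :=
  LinearMap.mk₂'ₛₗ (RingHom.id ℂ) (starRingEnd ℂ) (leviFun φ a)
    (by
      intro u u' v
      simp only [leviFun, smul_add, map_add, add_apply]
      push_cast; ring)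
    (by
      intro c u v
      simp only [leviFun, I_smul_smul_eq, map_sub, map_smul, sub_apply, smul_apply]
      simp only [smul_eq_re_im c u, map_add, map_smul, add_apply, smul_apply]
      apply Complex.ext <;> simp <;> ring)
    (by
      intro u v v'
      simp only [leviFun, smul_add, map_add]
      push_cast; ring)
    (by
      intro c u v
      simp only [leviFun, I_smul_smul_eq, map_sub, map_smul]
      simp only [smul_eq_re_im c v, map_add, map_smul]
      apply Complex.ext <;> simp <;> ring)

/-! ### Hermitian metrics, curvature and positivity -/

/-- A smooth Hermitian metric on a holomorphic vector bundle `V` with model fibre `F` over a complex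
manifold `B` of dimension `d`: a positive definite Hermitian form on every fibre, whose coefficients
with respect to the holomorphic local frames are (real) `C^∞` functions on `B`. -/
structure HermitianMetric (d : ℕ) {B : Type*} [TopologicalSpace B] [ChartedSpace (Cn d) B]
    (F : Type*) [NormedAddCommGroup F] [NormedSpace ℂ F]
    (V : B → Type*) [TopologicalSpace (TotalSpace F V)] [∀ b, TopologicalSpace (V b)]
    [∀ b, AddCommGroup (V b)] [∀ b, Module ℂ (V b)] [FiberBundle F V] [VectorBundle ℂ F V] where
  /-- The Hermitian form on the fibre over `b`. -/
  form (b : B) : Sesq (V b)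
  conj_symm (b : B) (u v : V b) : form b u v = (starRingEnd ℂ) (form b v u)
  pos (b : B) (u : V b) (hu : u ≠ 0) : 0 < (form b u u).re
  smooth (e : Trivialization F (π F V)) [MemTrivializationAtlas e] (f g : F) :
    ContMDiffOn 𝓘(ℝ, Cn d) 𝓘(ℝ, ℂ) ∞ (fun b => form b (e.symm b f) (e.symm b g)) e.baseSet

section LineBundle

variable {d : ℕ} {X : Type*} [TopologicalSpace X] [ChartedSpace (Cn d) X]
  {L : X → Type*} [TopologicalSpace (TotalSpace ℂ L)] [∀ x, TopologicalSpace (L x)]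
  [∀ x, AddCommGroup (L x)] [∀ x, Module ℂ (L x)] [FiberBundle ℂ L] [VectorBundle ℂ ℂ L]

/-- The preferred local holomorphic frame of `L` around `x`, evaluated at `y`. -/
def localFrameAt (x y : X) : L y := (trivializationAt ℂ L x).symm y 1

/-- The local weight `φ = -log h(s, s)`, that is `h = e^{-φ}`, around `x`, in the preferred
holomorphic chart and the preferred holomorphic frame `s` of `L` at `x`. -/
def localWeight (h : HermitianMetric d ℂ L) (x : X) (z : Cn d) : ℝ :=
  let y : X := (chartAt (Cn d) x).symm z
  (-Real.log (h.form y (localFrameAt x y) (localFrameAt x y)).re)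

/-- The curvature `Θ = ∂∂̄φ` of `(L, h)` at `x`, as a Hermitian form on the tangent space `T_x X`:
`Θ(u, v̄) = ∑ φ_{j k̄} u_j v̄_k`. Tangent vectors at `x` are written in the preferred chart at `x`,
as `TangentSpace` prescribes. -/
def curvature (h : HermitianMetric d ℂ L) (x : X) : Sesq (TangentSpace 𝓘(ℂ, Cn d) x) :=
  leviForm (localWeight h x) (chartAt (Cn d) x x)

variable {m : ℕ} {Y : Type*} [TopologicalSpace Y] [ChartedSpace (Cn m) Y]

/-- The curvature of `(L, h)` is uniformly weakly RC-positive with respect to `p : X → Y`: it is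
positive on every fibre of `p`, and for any `t` there is a nonzero `v ∈ T_t Y` such that
`Θ(w, w̄) > 0` for every lift `w` of `v` to a tangent vector of `X` at a point of the fibre over
`t`. -/
def UniformlyWeaklyRCPositive (p : X → Y) (h : HermitianMetric d ℂ L) : Prop :=
  (∀ (x : X) (u : TangentSpace 𝓘(ℂ, Cn d) x), u ≠ 0 →
    mfderiv 𝓘(ℂ, Cn d) 𝓘(ℂ, Cn m) p x u = 0 → 0 < (curvature h x u u).re) ∧
  ∀ t : Y, ∃ v : TangentSpace 𝓘(ℂ, Cn m) t, v ≠ 0 ∧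
    ∀ (x : X) (w : TangentSpace 𝓘(ℂ, Cn d) x),
      tangentMap 𝓘(ℂ, Cn d) 𝓘(ℂ, Cn m) p ⟨x, w⟩ = ⟨t, v⟩ → 0 < (curvature h x w w).re

/-- The curvature of `(L, h)` at `x` as a `(1,1)`-form. -/
def curvatureForm (h : HermitianMetric d ℂ L) (x : X) : ExtForms d :=
  form11 (d := d) (curvature h x)

end LineBundle

/-- The `(1,1)`-form at `y` associated with a Hermitian metric on the tangent bundle. -/
def metricForm {m : ℕ} {Y : Type*} [TopologicalSpace Y] [ChartedSpace (Cn m) Y]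
    [IsManifold 𝓘(ℂ, Cn m) ω Y]
    (α : HermitianMetric m (Cn m) (TangentSpace 𝓘(ℂ, Cn m) : Y → Type _)) (y : Y) : ExtForms m :=
  form11 (d := m) (α.form y)

/-- Pullback under `p : X → Y` of an exterior form at `p x` to an exterior form at `x`. -/
def pullbackAt {d m : ℕ} {X : Type*} [TopologicalSpace X] [ChartedSpace (Cn d) X]
    {Y : Type*} [TopologicalSpace Y] [ChartedSpace (Cn m) Y] (p : X → Y) (x : X) :
    ExtForms m →ₐ[ℂ] ExtForms d :=
  pullbackForm (d := d) (d' := m) (mfderiv 𝓘(ℂ, Cn d) 𝓘(ℂ, Cn m) p x).toLinearMap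

end

/-!
# Positivity of `Θ^{n+1} ∧ p^*α^{m-1}` for uniformly weakly RC-positive curvature

At a point `x` of `X` let `C` be the Schur complement of the curvature `Θ` with respect to
`ker dp_x`: a Hermitian form on `T_{p x} Y` whose value at `w` is the value of `Θ` on the lift of
`w` that is `Θ`-orthogonal to the fibre. In a coframe `θ_1, …, θ_n, η_1, …, η_m` in which
`Θ = ∑ |θ_a|² + ∑ c_j |η_j|²` and `p^*α = ∑ |η_j|²`, the forms `i θ_a ∧ θ̄_a` and `i η_j ∧ η̄_j`
commute and have square zero, so that `Θ^{n+1} ∧ p^*α^{m-1} = (n+1)! (m-1)! (∑ c_j)` times the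
product of all these forms, which is a positive volume form. Hence positivity is equivalent to
`tr_α C > 0`; the direction needed is `exists_schurComplement`.

With `B = α⁻¹` the dual metric, `tr_α C = tr (C B)` is linear in `B`. Dual metrics satisfying the
condition can therefore be glued by a partition of unity on `Y`, and it suffices to find them
locally. Near `t`, with `v` the unit vector of the RC-positivity hypothesis, a compactness argument
on the unit sphere gives `Θ(u, ū) ≥ δ |⟨v, dp u⟩|² - K |dp u - ⟨v, dp u⟩ v|²` for `x` near any given
point of the fibre (`eventually_estimate`), and properness of `p` makes this uniform near the fibre
(`eventually_fiber_estimate`). Then `B = v v^* + ε`, constant in the chart at `t`, has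
`tr (C B) > 0` for small `ε` (`exists_local_dualMetric`).

Since `curvature h x` is computed in the chart and frame preferred at `x`, its continuity in `x`
rests on its invariance under changes of chart and frame (`coordCurvature_eq_leviFun`): the complex
Hessian pulls back under holomorphic maps and `log |g|²` is pluriharmonic for a transition
function `g`. The metric `α` is the inverse of the glued dual metric (`gluedMetric`).
-/

noncomputable section

/-! ### Products of commuting square-zero elements -/

section SquareZero

variable {R : Type*} [CommRing R] {ι : Type*}

theorem sum_pow_card_succ_eq_zero_of_sq_eq_zero [DecidableEq ι] (r : ι → R)
    (hr : ∀ i, r i * r i = 0) (s : Finset ι) (k : ℕ) (hk : s.card < k) :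
    (∑ i ∈ s, r i) ^ k = 0 := by
  induction s using Finset.induction_on generalizing k with
  | empty => simp only [Finset.sum_empty]; exact zero_pow (by omega)
  | insert a s ha ih =>
    rw [Finset.card_insert_of_notMem ha] at hk
    obtain ⟨k, rfl⟩ : ∃ j, k = j + 1 := ⟨k - 1, by omega⟩
    rw [Finset.sum_insert ha, add_pow]
    refine Finset.sum_eq_zero fun i hi => ?_
    match i with
    | 0 => simp [ih (k + 1) (by omega)]
    | 1 => simp [ih k (by omega)]
    | i + 2 => simp [pow_add, pow_two, hr]

theorem sum_pow_card_of_sq_eq_zero [DecidableEq ι] (r : ι → R)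
    (hr : ∀ i, r i * r i = 0) (s : Finset ι) :
    (∑ i ∈ s, r i) ^ s.card = (s.card.factorial : R) * ∏ i ∈ s, r i := by
  induction s using Finset.induction_on with
  | empty => simp
  | insert a s ha ih =>
    rw [Finset.sum_insert ha, Finset.prod_insert ha, Finset.card_insert_of_notMem ha, add_pow,
      Finset.sum_eq_single 1]
    · simp only [pow_one, add_tsub_cancel_right, ih, Nat.choose_one_right, Nat.factorial_succ]
      push_cast; ring
    · intro i hi hi1
      match i with
      | 0 => simp [sum_pow_card_succ_eq_zero_of_sq_eq_zero r hr s (s.card + 1) (by omega)]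
      | 1 => exact absurd rfl hi1
      | i + 2 => simp [pow_add, pow_two, hr]
    · intro h; simp at h

theorem mul_sum_pow_pred_of_sq_eq_zero [DecidableEq ι] (r : ι → R)
    (hr : ∀ i, r i * r i = 0) (s : Finset ι) (j : ι) (hj : j ∈ s) :
    r j * (∑ i ∈ s, r i) ^ (s.card - 1) = ((s.card - 1).factorial : R) * ∏ i ∈ s, r i := by
  have hc := Finset.card_erase_of_mem hj
  have h1 : ∀ k, r j * (∑ i ∈ s, r i) ^ k = r j * (∑ i ∈ s.erase j, r i) ^ k := by
    intro k
    induction k with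
    | zero => simp
    | succ k ih =>
      rw [pow_succ, ← mul_assoc, ih, ← Finset.add_sum_erase s r hj, mul_add, pow_succ]
      linear_combination ((∑ i ∈ s.erase j, r i) ^ k) * hr j
  rw [h1, ← hc, sum_pow_card_of_sq_eq_zero r hr, ← Finset.mul_prod_erase s r hj]
  ring

/-- The top-degree part of `(∑ s_a + ∑ c_j r_j)^{n+1} (∑ r_j)^{m-1}`: every factor `r_j` occurs at
most once, so exactly one factor `c_j r_j` is taken from the first power. -/
theorem sum_pow_mul_sum_pow_of_sq_eq_zero {n m : ℕ} (s : Fin n → R) (r c : Fin m → R)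
    (hs : ∀ i, s i * s i = 0) (hr : ∀ i, r i * r i = 0) :
    (∑ a, s a + ∑ j, c j * r j) ^ (n + 1) * (∑ j, r j) ^ (m - 1) =
      (((n + 1).factorial * (m - 1).factorial : ℕ) : R) * (∑ j, c j) *
        ((∏ a, s a) * ∏ j, r j) := by
  have hS1 := sum_pow_card_succ_eq_zero_of_sq_eq_zero s hs Finset.univ (n + 1) (by simp)
  have hS := sum_pow_card_of_sq_eq_zero s hs Finset.univ
  have hR : ∀ j, r j * (∑ j, r j) ^ (m - 1) = ((m - 1).factorial : R) * ∏ i, r i := fun j => by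
    simpa using mul_sum_pow_pred_of_sq_eq_zero r hr Finset.univ j (Finset.mem_univ j)
  have hRR : ∀ j, r j * ∏ i, r i = 0 := fun j => by
    rw [← Finset.mul_prod_erase _ r (Finset.mem_univ j), ← mul_assoc, hr, zero_mul]
  have hc : (∑ j, c j * r j) * (∑ j, r j) ^ (m - 1) =
      (∑ j, c j) * (((m - 1).factorial : R) * ∏ i, r i) := by
    rw [Finset.sum_mul, Finset.sum_mul]
    exact Finset.sum_congr rfl fun j _ => by rw [mul_assoc, hR]
  have hcc : (∑ j, c j * r j) * ∏ i, r i = 0 := by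
    rw [Finset.sum_mul]
    exact Finset.sum_eq_zero fun j _ => by rw [mul_assoc, hRR, mul_zero]
  have h2 : ∀ k, 2 ≤ k → (∑ j, c j * r j) ^ k * (∑ j, r j) ^ (m - 1) = 0 := by
    intro k hk
    obtain ⟨k, rfl⟩ : ∃ i, k = i + 2 := ⟨k - 2, by omega⟩
    rw [pow_add, pow_two]
    linear_combination (∑ j, c j * r j) ^ k * (∑ j, c j * r j) * hc +
      (∑ j, c j * r j) ^ k * (∑ j, c j) * ((m - 1).factorial : R) * hcc
  simp only [Finset.card_univ, Fintype.card_fin] at hS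
  rw [add_comm, add_pow, Finset.sum_mul, Finset.sum_eq_single 1]
  · simp only [pow_one, add_tsub_cancel_right, Nat.choose_one_right, hS, Nat.factorial_succ]
    push_cast
    linear_combination ((n.factorial : R) * (∏ a, s a) * (n + 1)) * hc
  · intro i hi hi1
    match i with
    | 0 => simp [hS1]
    | 1 => exact absurd rfl hi1
    | i + 2 =>
      linear_combination ((∑ a, s a) ^ (n + 1 - (i + 2)) * ((n + 1).choose (i + 2) : R)) *
        h2 (i + 2) (by omega)
  · intro h; simp at h

end SquareZero

/-! ### Forms `i η ∧ η̄` -/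

/-- The conjugate `η̄` of a complex linear functional, as a complex-valued covector. -/
def conjCovector {d : ℕ} (η : Cn d →ₗ[ℂ] ℂ) : CplxCotangent d :=
  conjAe.toLinearMap ∘ₗ η.restrictScalars ℝ

/-- The `(1,1)`-form `i η ∧ η̄` of a complex linear functional `η`. -/
def pairForm {d : ℕ} (η : Cn d →ₗ[ℂ] ℂ) : ExtForms d :=
  I • (ExteriorAlgebra.ι ℂ (η.restrictScalars ℝ : CplxCotangent d) *
    ExteriorAlgebra.ι ℂ (conjCovector η))

section ExtAlg

variable {M : Type*} [AddCommGroup M] [Module ℂ M]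

theorem ι_mul_ι_anticomm (a b : M) : ExteriorAlgebra.ι ℂ a * ExteriorAlgebra.ι ℂ b =
    -(ExteriorAlgebra.ι ℂ b * ExteriorAlgebra.ι ℂ a) :=
  eq_neg_of_add_eq_zero_left (ExteriorAlgebra.ι_add_mul_swap a b)

theorem commute_ι_mul_ι (a b c : M) :
    Commute (ExteriorAlgebra.ι ℂ a * ExteriorAlgebra.ι ℂ b) (ExteriorAlgebra.ι ℂ c) := by
  rw [commute_iff_eq, mul_assoc, ι_mul_ι_anticomm b c, mul_neg, ← mul_assoc, ι_mul_ι_anticomm a c,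
    neg_mul, neg_neg, mul_assoc]

theorem ι_mul_prod_ofFn {d : ℕ} (b : M) (a : Fin d → M) :
    ExteriorAlgebra.ι ℂ b * (List.ofFn fun k => ExteriorAlgebra.ι ℂ (a k)).prod =
      (-1 : ℂ) ^ d • ((List.ofFn fun k => ExteriorAlgebra.ι ℂ (a k)).prod *
        ExteriorAlgebra.ι ℂ b) := by
  induction d with
  | zero => simp
  | succ d ih =>
    rw [List.ofFn_succ, List.prod_cons, ← mul_assoc, ι_mul_ι_anticomm, neg_mul, mul_assoc, ih,
      mul_smul_comm, pow_succ, mul_neg_one, neg_smul, mul_assoc]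

/-- Sorting a product of pairs `a_k ∧ b_k` into the product of the `a_k` followed by the product of
the `b_k` costs a sign depending only on the number of pairs. -/
theorem exists_prod_ofFn_ι_mul_ι_eq (d : ℕ) : ∃ s : ℂ, ∀ a b : Fin d → M,
    (List.ofFn fun k => ExteriorAlgebra.ι ℂ (a k) * ExteriorAlgebra.ι ℂ (b k)).prod =
      s • ((List.ofFn fun k => ExteriorAlgebra.ι ℂ (a k)).prod *
        (List.ofFn fun k => ExteriorAlgebra.ι ℂ (b k)).prod) := by
  induction d with
  | zero => exact ⟨1, by simp⟩
  | succ d ih =>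
    obtain ⟨s, hs⟩ := ih
    refine ⟨s * (-1) ^ d, fun a b => ?_⟩
    simp only [List.ofFn_succ, List.prod_cons]
    rw [hs, mul_smul_comm, mul_assoc (ExteriorAlgebra.ι ℂ (a 0)),
      ← mul_assoc (ExteriorAlgebra.ι ℂ (b 0)), ι_mul_prod_ofFn, smul_mul_assoc, mul_smul_comm,
      smul_smul, mul_assoc, mul_assoc]

theorem prod_ofFn_ι_linearCombination {d : ℕ} (e : Fin d → M) (A : Matrix (Fin d) (Fin d) ℂ) :
    (List.ofFn fun k => ExteriorAlgebra.ι ℂ (∑ j, A k j • e j)).prod =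
      A.det • (List.ofFn fun k => ExteriorAlgebra.ι ℂ (e k)).prod := by
  simp only [← ExteriorAlgebra.ιMulti_apply]
  have key : (ExteriorAlgebra.ιMulti ℂ d).compLinearMap (Fintype.linearCombination ℂ e) =
      (LinearMap.toSpanSingleton ℂ _ (ExteriorAlgebra.ιMulti ℂ d e)).compAlternatingMap
        (Matrix.detRowAlternating (n := Fin d) (R := ℂ)) := by
    refine (Pi.basisFun ℂ (Fin d)).ext_alternating fun v hv => ?_
    obtain ⟨σ, rfl⟩ : ∃ σ : Equiv.Perm (Fin d), v = σ :=
      ⟨Equiv.ofBijective v (Finite.injective_iff_bijective.1 hv), rfl⟩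
    refine ((AlternatingMap.map_perm _ (Pi.basisFun ℂ (Fin d)) σ).trans ?_).trans
      (AlternatingMap.map_perm _ (Pi.basisFun ℂ (Fin d)) σ).symm
    congr 1
    have h1 : (Matrix.detRowAlternating (n := Fin d) (R := ℂ)) (Pi.basisFun ℂ (Fin d)) = 1 := by
      rw [← Pi.basisFun_det, Module.Basis.det_self]
    rw [LinearMap.compAlternatingMap_apply, h1]
    simp [AlternatingMap.compLinearMap_apply]
  exact congrArg (fun f => f A) key

end ExtAlg

theorem commute_pairForm {d : ℕ} (η ξ : Cn d →ₗ[ℂ] ℂ) : Commute (pairForm η) (pairForm ξ) :=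
  (((commute_ι_mul_ι _ _ _).mul_right (commute_ι_mul_ι _ _ _)).smul_left I).smul_right I

theorem pairForm_mul_self {d : ℕ} (η : Cn d →ₗ[ℂ] ℂ) : pairForm η * pairForm η = 0 := by
  simp only [pairForm, smul_mul_smul_comm]
  rw [← mul_assoc, (commute_ι_mul_ι _ _ _).eq, ← mul_assoc, ExteriorAlgebra.ι_sq_zero]
  simp

@[simp] theorem dz_apply {d : ℕ} (k : Fin d) (u : Cn d) : dz k u = u k := rfl

@[simp] theorem dzbar_apply {d : ℕ} (k : Fin d) (u : Cn d) : dzbar k u = (starRingEnd ℂ) (u k) :=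
  rfl

theorem restrictScalars_eq_sum_dz {d : ℕ} (η : Cn d →ₗ[ℂ] ℂ) :
    (η.restrictScalars ℝ : CplxCotangent d) = ∑ j, η (stdVec j) • dz j := by
  ext u
  have hu : u = ∑ j, u j • (stdVec j : Cn d) := by
    ext i
    simp [stdVec, Finset.sum_apply, Pi.single_apply]
  conv_lhs => rw [LinearMap.restrictScalars_apply, hu, map_sum]
  simp [mul_comm, LinearMap.sum_apply]

theorem conjCovector_eq_sum_dzbar {d : ℕ} (η : Cn d →ₗ[ℂ] ℂ) :
    conjCovector η = ∑ j, (starRingEnd ℂ) (η (stdVec j)) • dzbar j := by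
  ext u
  have h := congrArg (fun f => (starRingEnd ℂ) (f u)) (restrictScalars_eq_sum_dz η)
  simpa [conjCovector, LinearMap.sum_apply] using h

theorem pairForm_eq_sum {d : ℕ} (η : Cn d →ₗ[ℂ] ℂ) :
    pairForm η = ∑ j, ∑ k,
      (I * (η (stdVec j) * (starRingEnd ℂ) (η (stdVec k)))) • dzdzbar j k := by
  rw [pairForm, restrictScalars_eq_sum_dz, conjCovector_eq_sum_dzbar]
  simp only [map_sum, map_smul, Finset.sum_mul_sum, smul_mul_smul_comm, Finset.smul_sum, smul_smul,
    dzdzbar]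

/-- A diagonalization of a sesquilinear form diagonalizes the associated `(1,1)`-form. -/
theorem form11_eq_sum_pairForm {d : ℕ} {ι : Type*} [Fintype ι] (H : Sesq (Cn d)) (c : ι → ℂ)
    (η : ι → Cn d →ₗ[ℂ] ℂ)
    (h : ∀ u v, H u v = ∑ l, c l * (η l u * (starRingEnd ℂ) (η l v))) :
    form11 H = ∑ l, c l • pairForm (η l) := by
  simp only [form11, pairForm_eq_sum, h, Finset.smul_sum, smul_smul, Finset.mul_sum, Finset.sum_smul]
  refine ((Finset.sum_congr rfl fun j _ => Finset.sum_comm).trans Finset.sum_comm).trans ?_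
  refine Finset.sum_congr rfl fun l _ => Finset.sum_congr rfl fun j _ =>
    Finset.sum_congr rfl fun k _ => ?_
  rw [mul_left_comm]

theorem pullbackForm_pairForm {d d' : ℕ} (A : Cn d →ₗ[ℂ] Cn d') (η : Cn d' →ₗ[ℂ] ℂ) :
    pullbackForm A (pairForm η) = pairForm (η ∘ₗ A) := by
  simp only [pullbackForm, pairForm, map_smul, map_mul, ExteriorAlgebra.map_apply_ι]
  rfl

/-- The linear functional `z ↦ ∑ a_j z_j`. -/
def coordFunctional {d : ℕ} (a : Fin d → ℂ) : Cn d →ₗ[ℂ] ℂ where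
  toFun u := ∑ j, a j * u j
  map_add' u v := by simp [mul_add, Finset.sum_add_distrib]
  map_smul' c u := by simp [Finset.mul_sum, mul_left_comm]

theorem coordFunctional_stdVec {d : ℕ} (a : Fin d → ℂ) (j : Fin d) :
    coordFunctional a (stdVec j) = a j := by
  simp [coordFunctional, stdVec]

/-- The form `∏ i ξ_k ∧ ξ̄_k` is `|det|²` times the standard volume form. -/
theorem prod_ofFn_pairForm {d : ℕ} (A : Matrix (Fin d) (Fin d) ℂ) :
    (List.ofFn fun k => pairForm (coordFunctional (A k))).prod =
      (Complex.normSq A.det : ℂ) • volForm d := by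
  obtain ⟨s, hs⟩ := exists_prod_ofFn_ι_mul_ι_eq (M := CplxCotangent d) d
  have hI : ∀ f : Fin d → ExtForms d, (List.ofFn fun k => I • f k).prod =
      I ^ d • (List.ofFn f).prod := by
    have : ∀ (e : ℕ) (f : Fin e → ExtForms d), (List.ofFn fun k => I • f k).prod =
        I ^ e • (List.ofFn f).prod := by
      intro e
      induction e with
      | zero => simp
      | succ e ih =>
        intro f
        rw [List.ofFn_succ, List.prod_cons, ih, List.ofFn_succ, List.prod_cons,
          smul_mul_smul_comm, pow_succ']
    exact this d
  simp only [pairForm, volForm, dzdzbar, hI, hs, restrictScalars_eq_sum_dz,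
    conjCovector_eq_sum_dzbar, coordFunctional_stdVec]
  rw [prod_ofFn_ι_linearCombination dz A]
  have hbar := prod_ofFn_ι_linearCombination dzbar (A.map (starRingEnd ℂ))
  simp only [Matrix.map_apply] at hbar
  rw [hbar]
  have hdet : (A.map (starRingEnd ℂ)).det = (starRingEnd ℂ) A.det :=
    ((starRingEnd ℂ).map_det A).symm
  rw [hdet, smul_mul_smul_comm, Complex.mul_conj, smul_comm s, smul_comm (I ^ d)]

/-- The top-degree computation for simultaneously diagonal `(1,1)`-forms. -/
theorem sum_pairForm_pow_mul_pow {n m : ℕ} (ξ : Fin (n + m) → Cn (n + m) →ₗ[ℂ] ℂ)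
    (c : Fin m → ℂ) :
    (∑ a, pairForm (ξ (Fin.castAdd m a)) + ∑ j, c j • pairForm (ξ (Fin.natAdd n j))) ^ (n + 1) *
        (∑ j, pairForm (ξ (Fin.natAdd n j))) ^ (m - 1) =
      (((n + 1).factorial * (m - 1).factorial : ℕ) * (∑ j, c j)) •
        (List.ofFn fun k => pairForm (ξ k)).prod := by
  let S := Algebra.adjoin ℂ (Set.range fun k => pairForm (ξ k))
  have hS : IsMulCommutative S := Algebra.isMulCommutative_adjoin ℂ (by
    rintro _ ⟨i, rfl⟩ _ ⟨j, rfl⟩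
    exact commute_pairForm _ _)
  let _ : CommRing S := { (inferInstance : Ring S) with mul_comm := hS.is_comm.comm }
  let τ : Fin (n + m) → S := fun k => ⟨pairForm (ξ k), Algebra.subset_adjoin ⟨k, rfl⟩⟩
  have hτ : ∀ k, τ k * τ k = 0 := fun k => Subtype.ext (pairForm_mul_self _)
  have key := sum_pow_mul_sum_pow_of_sq_eq_zero (R := S) (fun a => τ (Fin.castAdd m a))
    (fun j => τ (Fin.natAdd n j)) (fun j => algebraMap ℂ S (c j)) (fun _ => hτ _) (fun _ => hτ _)
  rw [← Fin.prod_univ_add, ← List.prod_ofFn] at key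
  have := congrArg S.val key
  simp only [← Algebra.smul_def] at this
  rw [Algebra.smul_def, map_mul, map_natCast]
  simpa [map_list_prod, List.map_ofFn, τ, Function.comp_def, ← map_sum] using this

/-! ### Simultaneous diagonalization -/

section MatrixAlgebra

open Matrix
open scoped ComplexOrder

theorem Matrix.PosDef.exists_mul_conjTranspose {ι : Type*} [Fintype ι] [DecidableEq ι]
    {B : Matrix ι ι ℂ} (hB : B.PosDef) : ∃ S : Matrix ι ι ℂ, S * Sᴴ = B := by
  let U : Matrix ι ι ℂ := hB.1.eigenvectorUnitary
  refine ⟨U * diagonal fun i => (Real.sqrt (hB.1.eigenvalues i) : ℂ), ?_⟩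
  conv_rhs => rw [hB.1.spectral_theorem, Unitary.conjStarAlgAut_apply]
  rw [conjTranspose_mul, diagonal_conjTranspose, Matrix.mul_assoc, ← Matrix.mul_assoc (diagonal _),
    diagonal_mul_diagonal, ← Matrix.mul_assoc]
  congr 3
  ext i
  simp only [Pi.star_apply, RCLike.star_def, conj_ofReal, Function.comp]
  rw [← ofReal_mul, Real.mul_self_sqrt (hB.eigenvalues_pos i).le]
  rfl

theorem Matrix.PosDef.exists_simultaneous_diagonalization {ι : Type*} [Fintype ι] [DecidableEq ι]
    {B C : Matrix ι ι ℂ} (hB : B.PosDef) (hC : C.IsHermitian) :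
    ∃ (G : Matrix ι ι ℂ) (c : ι → ℝ), G * Gᴴ = B ∧ Gᴴ * C * G = diagonal fun i => (c i : ℂ) := by
  obtain ⟨S, hS⟩ := hB.exists_mul_conjTranspose
  have hD : (Sᴴ * C * S).IsHermitian := isHermitian_conjTranspose_mul_mul S hC
  let U : Matrix ι ι ℂ := hD.eigenvectorUnitary
  have hU : U * Uᴴ = 1 := Unitary.coe_mul_star_self hD.eigenvectorUnitary
  have hU' : Uᴴ * U = 1 := Unitary.coe_star_mul_self hD.eigenvectorUnitary
  refine ⟨S * U, hD.eigenvalues, ?_, ?_⟩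
  · rw [conjTranspose_mul, Matrix.mul_assoc, ← Matrix.mul_assoc U, hU, Matrix.one_mul, hS]
  · have h := hD.spectral_theorem
    rw [Unitary.conjStarAlgAut_apply] at h
    calc (S * U)ᴴ * C * (S * U) = Uᴴ * (Sᴴ * C * S) * U := by
          rw [conjTranspose_mul]; simp only [Matrix.mul_assoc]
      _ = Uᴴ * (U * diagonal (RCLike.ofReal ∘ hD.eigenvalues) * Uᴴ) * U := by
          conv_lhs => rw [h]
          rfl
      _ = (Uᴴ * U) * diagonal (RCLike.ofReal ∘ hD.eigenvalues) * (Uᴴ * U) := by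
          simp only [Matrix.mul_assoc]
      _ = _ := by rw [hU', Matrix.one_mul, Matrix.mul_one]; rfl

/-- For a Hermitian matrix `T` which is positive on the kernel of a surjective matrix `A`, the
columns of `K` are a `T`-orthonormal basis of `ker A`, and `R` is the right inverse of `A` with
values in the `T`-orthogonal complement of `ker A`. -/
theorem exists_orthonormal_kernel_and_orthogonal_lift {n m : ℕ}
    {T : Matrix (Fin (n + m)) (Fin (n + m)) ℂ} (hT : T.IsHermitian)
    {A : Matrix (Fin m) (Fin (n + m)) ℂ} (hA : Function.Surjective A.mulVec)
    (hpos : ∀ u, u ≠ 0 → A *ᵥ u = 0 → 0 < (star u ⬝ᵥ T *ᵥ u).re) :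
    ∃ (K : Matrix (Fin (n + m)) (Fin n) ℂ) (R : Matrix (Fin (n + m)) (Fin m) ℂ),
      A * K = 0 ∧ A * R = 1 ∧ Kᴴ * T * K = 1 ∧ Kᴴ * T * R = 0 := by
  have hreal : ∀ u, (star u ⬝ᵥ T *ᵥ u).im = 0 := fun u => hT.im_star_dotProduct_mulVec_self u
  obtain ⟨g, hg⟩ := A.mulVecLin.exists_rightInverse_of_surjective
    (LinearMap.range_eq_top.2 hA)
  let R₀ : Matrix (Fin (n + m)) (Fin m) ℂ := LinearMap.toMatrix' g
  have hR₀ : A * R₀ = 1 := by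
    rw [← LinearMap.toMatrix'_toLin' A, ← LinearMap.toMatrix'_comp, Matrix.toLin'_apply', hg,
      LinearMap.toMatrix'_id]
  have hdim : Module.finrank ℂ (LinearMap.ker A.mulVecLin) = n := by
    have := A.mulVecLin.finrank_range_add_finrank_ker
    rw [LinearMap.range_eq_top.2 hA] at this
    simp at this
    omega
  let b := Module.finBasisOfFinrankEq ℂ _ hdim
  let K₀ : Matrix (Fin (n + m)) (Fin n) ℂ := Matrix.of fun i j => (b j : Fin (n + m) → ℂ) i
  have hK₀v : ∀ w, K₀ *ᵥ w = ((∑ j, w j • b j : LinearMap.ker A.mulVecLin) : Fin (n + m) → ℂ) := by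
    intro w
    ext i
    simp [K₀, Matrix.mulVec, dotProduct, mul_comm]
  have hK₀ker : ∀ w, A *ᵥ (K₀ *ᵥ w) = 0 := fun w => by
    rw [hK₀v]; exact (∑ j, w j • b j : LinearMap.ker A.mulVecLin).2
  have hK₀inj : ∀ w, w ≠ 0 → K₀ *ᵥ w ≠ 0 := by
    intro w hw h
    rw [hK₀v] at h
    refine hw (funext fun j => ?_)
    exact Fintype.linearIndependent_iff.1 b.linearIndependent w (Subtype.ext h) j
  have hAK₀ : A * K₀ = 0 := by
    refine Matrix.ext_of_mulVec_single fun j => ?_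
    rw [← Matrix.mulVec_mulVec, hK₀ker, Matrix.zero_mulVec]
  have ha : (K₀ᴴ * T * K₀).PosDef := by
    refine PosDef.of_dotProduct_mulVec_pos (isHermitian_conjTranspose_mul_mul K₀ hT) fun w hw => ?_
    have h1 : star w ⬝ᵥ (K₀ᴴ * T * K₀) *ᵥ w = star (K₀ *ᵥ w) ⬝ᵥ T *ᵥ (K₀ *ᵥ w) := by
      rw [star_mulVec, ← dotProduct_mulVec, ← Matrix.mulVec_mulVec, ← Matrix.mulVec_mulVec]
    rw [h1, Complex.lt_def]
    exact ⟨hpos _ (hK₀inj w hw) (hK₀ker w), (hreal _).symm⟩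
  obtain ⟨S, hS⟩ := ha.exists_mul_conjTranspose
  have hSu : IsUnit S.det := by
    have := (Matrix.isUnit_iff_isUnit_det _).1 ha.isUnit
    rw [← hS, det_mul] at this
    exact isUnit_of_mul_isUnit_left this
  have hK : (K₀ * S⁻¹ᴴ)ᴴ * T * (K₀ * S⁻¹ᴴ) = 1 := by
    calc (K₀ * S⁻¹ᴴ)ᴴ * T * (K₀ * S⁻¹ᴴ) = S⁻¹ * (K₀ᴴ * T * K₀) * S⁻¹ᴴ := by
          rw [conjTranspose_mul, conjTranspose_conjTranspose]; simp only [Matrix.mul_assoc]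
      _ = (S⁻¹ * S) * (S⁻¹ * S)ᴴ := by
          rw [← hS, conjTranspose_mul]; simp only [Matrix.mul_assoc]
      _ = 1 := by rw [nonsing_inv_mul _ hSu]; simp
  set K := K₀ * S⁻¹ᴴ with hKdef
  have hAK : A * K = 0 := by rw [hKdef, ← Matrix.mul_assoc, hAK₀, Matrix.zero_mul]
  refine ⟨K, R₀ - K * (Kᴴ * T * R₀), hAK, ?_, hK, ?_⟩
  · rw [Matrix.mul_sub, hR₀, ← Matrix.mul_assoc, hAK, Matrix.zero_mul, sub_zero]
  · rw [Matrix.mul_sub, ← Matrix.mul_assoc _ K, hK, Matrix.one_mul, sub_self]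

/-- Diagonalization of `T` in a frame adapted to the surjection `A`. With `C = Rᴴ T R` the Schur
complement of `T`, and `B = G Gᴴ`, the rows of `Ξ` are the coframe `(θ, η)` with `η = G⁻¹ A`. -/
theorem exists_adapted_coframe {n m : ℕ}
    {T : Matrix (Fin (n + m)) (Fin (n + m)) ℂ} (hT : T.IsHermitian)
    {A : Matrix (Fin m) (Fin (n + m)) ℂ}
    {K : Matrix (Fin (n + m)) (Fin n) ℂ} {R : Matrix (Fin (n + m)) (Fin m) ℂ}
    (hAK : A * K = 0) (hAR : A * R = 1) (hK : Kᴴ * T * K = 1) (hKR : Kᴴ * T * R = 0)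
    {G : Matrix (Fin m) (Fin m) ℂ} (hG : IsUnit G.det) {c : Fin m → ℝ}
    (hc : Gᴴ * (Rᴴ * T * R) * G = diagonal fun i => (c i : ℂ)) :
    ∃ Θ : Matrix (Fin n) (Fin (n + m)) ℂ,
      ((fromRows Θ (G⁻¹ * A)).submatrix finSumFinEquiv.symm id).det ≠ 0 ∧
      T = Θᴴ * Θ + (G⁻¹ * A)ᴴ * (diagonal fun i => (c i : ℂ)) * (G⁻¹ * A) := by
  have hRK : Rᴴ * T * K = 0 := by
    have := congrArg conjTranspose hKR
    simpa [conjTranspose_mul, hT.eq, Matrix.mul_assoc] using this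
  have h1 : fromRows (Kᴴ * T) (G⁻¹ * A) * fromCols K (R * G) = 1 := by
    rw [fromRows_mul_fromCols, hK, ← Matrix.mul_assoc, hKR, Matrix.zero_mul, Matrix.mul_assoc, hAK,
      Matrix.mul_zero, Matrix.mul_assoc, ← Matrix.mul_assoc A, hAR, Matrix.one_mul,
      nonsing_inv_mul _ hG, fromBlocks_one]
  have h2 : fromCols K (R * G) * fromRows (Kᴴ * T) (G⁻¹ * A) = 1 :=
    (fromCols_mul_fromRows_eq_one_comm finSumFinEquiv.symm _ _ _ _).2 h1
  refine ⟨Kᴴ * T, ?_, ?_⟩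
  · have h3 : (fromRows (Kᴴ * T) (G⁻¹ * A)).submatrix finSumFinEquiv.symm id *
        (fromCols K (R * G)).submatrix id finSumFinEquiv.symm = 1 := by
      rw [← submatrix_mul _ _ _ _ _ Function.bijective_id, h1, submatrix_one_equiv]
    intro h0
    have := congrArg det h3
    rw [det_mul, h0, zero_mul, det_one] at this
    exact zero_ne_one this
  · have h4 : (fromCols K (R * G))ᴴ * T * fromCols K (R * G) =
        fromBlocks 1 0 0 (diagonal fun i => (c i : ℂ)) := by
      rw [conjTranspose_fromCols_eq_fromRows_conjTranspose, fromRows_mul, fromRows_mul_fromCols, hK,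
        ← Matrix.mul_assoc, hKR, Matrix.zero_mul, conjTranspose_mul, ← hc]
      congr 1
      · rw [Matrix.mul_assoc, Matrix.mul_assoc, ← Matrix.mul_assoc Rᴴ, hRK, Matrix.mul_zero]
      · simp only [Matrix.mul_assoc]
    set F := fromCols K (R * G)
    set Ξ := fromRows (Kᴴ * T) (G⁻¹ * A) with hΞ
    have h5 : T = Ξᴴ * (Fᴴ * T * F) * Ξ := by
      calc T = (F * Ξ)ᴴ * T * (F * Ξ) := by rw [h2]; simp
        _ = _ := by rw [conjTranspose_mul]; simp only [Matrix.mul_assoc]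
    rw [h4, hΞ, conjTranspose_fromRows_eq_fromCols_conjTranspose, fromCols_mul_fromBlocks,
      fromCols_mul_fromRows] at h5
    simpa using h5

end MatrixAlgebra

/-! ### The pointwise criterion -/

/-- The matrix of a sesquilinear form: `H(u, v) = v^* M u`. -/
def sesqMatrix {d : ℕ} (H : Sesq (Cn d)) : Matrix (Fin d) (Fin d) ℂ :=
  Matrix.of fun k j => H (stdVec j) (stdVec k)

/-- The matrix of a linear map in the standard bases. -/
def linMatrix {d d' : ℕ} (A : Cn d →ₗ[ℂ] Cn d') : Matrix (Fin d') (Fin d) ℂ :=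
  Matrix.of fun i j => A (stdVec j) i

open Matrix in
theorem linMatrix_mulVec {d d' : ℕ} (A : Cn d →ₗ[ℂ] Cn d') (u : Cn d) :
    linMatrix A *ᵥ u.ofLp = (A u).ofLp := by
  have hu : u = ∑ j, u j • (stdVec j : Cn d) := by
    ext i
    simp [stdVec, Finset.sum_apply, Pi.single_apply]
  conv_rhs => rw [hu, map_sum]
  ext i
  simp [linMatrix, mulVec, dotProduct, mul_comm]

open Matrix in
theorem sesq_apply_eq {d : ℕ} (H : Sesq (Cn d)) (u v : Cn d) :
    H u v = star v.ofLp ⬝ᵥ sesqMatrix H *ᵥ u.ofLp := by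
  have hu : ∀ u : Cn d, u = ∑ j, u j • (stdVec j : Cn d) := by
    intro u
    ext i
    simp [stdVec, Finset.sum_apply, Pi.single_apply]
  conv_lhs => rw [hu u, hu v]
  simp only [map_sum, LinearMap.sum_apply, map_smulₛₗ, LinearMap.smul_apply, RingHom.id_apply,
    smul_eq_mul, sesqMatrix, mulVec, dotProduct, Pi.star_apply, Finset.mul_sum, Matrix.of_apply,
    RCLike.star_def]
  refine Finset.sum_congr rfl fun i _ => Finset.sum_congr rfl fun j _ => ?_
  ring

theorem linMatrix_comp {d d' d'' : ℕ} (A : Cn d →ₗ[ℂ] Cn d') (A' : Cn d' →ₗ[ℂ] Cn d'') :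
    linMatrix (A' ∘ₗ A) = linMatrix A' * linMatrix A := by
  ext i j
  exact (congrFun (linMatrix_mulVec A' (A (stdVec j))) i).symm

theorem sesqMatrix_isHermitian {d : ℕ} {H : Sesq (Cn d)}
    (hH : ∀ u v, H u v = (starRingEnd ℂ) (H v u)) : (sesqMatrix H).IsHermitian := by
  ext i j
  exact (hH _ _).symm

open Matrix in
theorem coordFunctional_eq_mulVec {d : ℕ} {ι : Type*} (M : Matrix ι (Fin d) ℂ) (k : ι) (u : Cn d) :
    coordFunctional (M k) u = (M *ᵥ u.ofLp) k := rfl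

open Matrix in
theorem coordFunctional_comp {d d' : ℕ} (a : Fin d' → ℂ) (A : Cn d →ₗ[ℂ] Cn d') :
    coordFunctional a ∘ₗ A = coordFunctional (a ᵥ* linMatrix A) := by
  ext u
  change a ⬝ᵥ (A u).ofLp = (a ᵥ* linMatrix A) ⬝ᵥ u.ofLp
  rw [← dotProduct_mulVec, linMatrix_mulVec]

open Matrix in
open scoped ComplexOrder in
/-- The pointwise criterion. The matrix `C` is the Schur complement of `H` with respect to `ker A`:
its values are values of `H` on lifts, and `H^{n+1} ∧ A^*α^{m-1}` is positive if the trace of `C`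
with respect to `α` is positive. -/
theorem exists_schurComplement {n m : ℕ} {H : Sesq (Cn (n + m))}
    (hH : ∀ u v, H u v = (starRingEnd ℂ) (H v u)) {A : Cn (n + m) →ₗ[ℂ] Cn m}
    (hA : Function.Surjective A) (hpos : ∀ u, u ≠ 0 → A u = 0 → 0 < (H u u).re) :
    ∃ C : Matrix (Fin m) (Fin m) ℂ,
      (∀ w : Fin m → ℂ, ∃ u, (A u).ofLp = w ∧ H u u = star w ⬝ᵥ C *ᵥ w) ∧
      ∀ (α : Sesq (Cn m)) (B : Matrix (Fin m) (Fin m) ℂ), B.PosDef →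
        (∀ u v : Cn m, α u v = star v.ofLp ⬝ᵥ B⁻¹ *ᵥ u.ofLp) → 0 < (C * B).trace.re →
        IsPositiveTop (form11 H ^ (n + 1) * pullbackForm A (form11 α ^ (m - 1))) := by
  have hT := sesqMatrix_isHermitian hH
  obtain ⟨K, R, hAK, hAR, hK, hKR⟩ := exists_orthonormal_kernel_and_orthogonal_lift
    (A := linMatrix A) hT
    (fun w => by
      obtain ⟨u, hu⟩ := hA (WithLp.toLp 2 w)
      exact ⟨u.ofLp, by rw [linMatrix_mulVec, hu]⟩)
    (fun u hu hAu => by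
      have := hpos (WithLp.toLp 2 u) (by simpa using hu) (by
        apply (WithLp.ofLp_injective 2)
        rw [← linMatrix_mulVec]; simpa using hAu)
      rwa [sesq_apply_eq] at this)
  refine ⟨Rᴴ * sesqMatrix H * R, fun w => ⟨WithLp.toLp 2 (R *ᵥ w), ?_, ?_⟩, ?_⟩
  · rw [← linMatrix_mulVec, Matrix.mulVec_mulVec, hAR, Matrix.one_mulVec]
  · rw [sesq_apply_eq, star_mulVec, ← dotProduct_mulVec, ← Matrix.mulVec_mulVec,
      ← Matrix.mulVec_mulVec]
  intro α B hB hα htr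
  obtain ⟨G, c, hG, hc⟩ := hB.exists_simultaneous_diagonalization
    (isHermitian_conjTranspose_mul_mul R hT)
  have hGu : IsUnit G.det := by
    have := (Matrix.isUnit_iff_isUnit_det _).1 hB.isUnit
    rw [← hG, det_mul] at this
    exact isUnit_of_mul_isUnit_left this
  obtain ⟨Θ, hdet, hTΘ⟩ := exists_adapted_coframe hT hAK hAR hK hKR hGu hc
  have htrace : (Rᴴ * sesqMatrix H * R * B).trace = ∑ j, (c j : ℂ) := by
    rw [← hG, ← Matrix.mul_assoc, Matrix.trace_mul_comm, ← Matrix.mul_assoc, hc, trace_diagonal]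
  have hcpos : 0 < ∑ j, c j := by
    rw [htrace, ← ofReal_sum, ofReal_re] at htr
    exact htr
  set Ξ := (fromRows Θ (G⁻¹ * linMatrix A)).submatrix finSumFinEquiv.symm id with hΞ
  have hΞ1 : ∀ a, Ξ (Fin.castAdd m a) = Θ a := fun a => by
    ext j; simp [hΞ]
  have hΞ2 : ∀ j, Ξ (Fin.natAdd n j) = (G⁻¹ * linMatrix A) j := fun a => by
    ext j; simp [hΞ]
  -- in the coframe `Ξ` both forms are diagonal
  have hform : form11 H = ∑ a, pairForm (coordFunctional (Ξ (Fin.castAdd m a))) +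
      ∑ j, (c j : ℂ) • pairForm (coordFunctional (Ξ (Fin.natAdd n j))) := by
    rw [form11_eq_sum_pairForm (ι := Fin n ⊕ Fin m) H (Sum.elim (fun _ => 1) fun j => (c j : ℂ))
      (Sum.elim (fun a => coordFunctional (Ξ (Fin.castAdd m a)))
        fun j => coordFunctional (Ξ (Fin.natAdd n j)))]
    · simp
    · intro u v
      have h1 : ∀ (ι : Type) [Fintype ι] (M : Matrix ι (Fin (n + m)) ℂ) (w : ι → ℂ),
          star v.ofLp ⬝ᵥ Mᴴ *ᵥ w = ∑ l, w l * (starRingEnd ℂ) (coordFunctional (M l) v) := by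
        intro ι _ M w
        rw [dotProduct_mulVec, ← star_mulVec, dotProduct_comm]
        rfl
      rw [sesq_apply_eq, hTΘ, Matrix.add_mulVec, dotProduct_add, Matrix.mul_assoc,
        ← Matrix.mulVec_mulVec, ← Matrix.mulVec_mulVec, h1, h1, ← Matrix.mulVec_mulVec]
      simp [hΞ1, hΞ2, coordFunctional_eq_mulVec, mulVec_diagonal, mul_assoc]
  have hform' : pullbackForm A (form11 α) =
      ∑ j, pairForm (coordFunctional (Ξ (Fin.natAdd n j))) := by
    rw [form11_eq_sum_pairForm α (fun _ => 1) fun j => coordFunctional (G⁻¹ j)]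
    · simp only [one_smul, map_sum, pullbackForm_pairForm, coordFunctional_comp, hΞ2]
      rfl
    · intro u v
      have hBinv : B⁻¹ = G⁻¹ᴴ * G⁻¹ := by
        rw [← hG, Matrix.mul_inv_rev, conjTranspose_nonsing_inv]
      rw [hα, hBinv, ← Matrix.mulVec_mulVec, dotProduct_mulVec, ← star_mulVec, dotProduct_comm]
      simp [coordFunctional_eq_mulVec, dotProduct]
  have hprod := sum_pairForm_pow_mul_pow (fun k => coordFunctional (Ξ k)) fun j => (c j : ℂ)
  rw [prod_ofFn_pairForm, smul_smul] at hprod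
  rw [map_pow, hform, hform', hprod]
  refine ⟨((n + 1).factorial * (m - 1).factorial : ℕ) * (∑ j, c j) * normSq Ξ.det, ?_, ?_⟩
  · have := normSq_pos.2 hdet
    have h2 : (0 : ℝ) < ((n + 1).factorial * (m - 1).factorial : ℕ) := by
      exact_mod_cast Nat.mul_pos (Nat.factorial_pos _) (Nat.factorial_pos _)
    positivity
  · push_cast
    rfl

/-! ### The complex Hessian under holomorphic maps -/

section Levi

open scoped Topology
open Filter

variable {E F : Type*} [NormedAddCommGroup E] [NormedSpace ℂ E]
  [NormedAddCommGroup F] [NormedSpace ℂ F] [NormedSpace ℝ E] [NormedSpace ℝ F]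
  [IsScalarTower ℝ ℂ E] [IsScalarTower ℝ ℂ F]

theorem fderiv_fderiv_comp_holomorphic {φ : F → ℝ} {ψ : E → F} {a : E}
    (hφ : ContDiffAt ℝ 2 φ (ψ a)) (hψ : ContDiffAt ℂ 2 ψ a) (u v : E) :
    fderiv ℝ (fderiv ℝ (φ ∘ ψ)) a u v =
      fderiv ℝ (fderiv ℝ φ) (ψ a) (fderiv ℂ ψ a u) (fderiv ℂ ψ a v) +
        fderiv ℝ φ (ψ a) (fderiv ℂ (fderiv ℂ ψ) a u v) := by
  have hψc : ContinuousAt ψ a := hψ.continuousAt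
  have hev : fderiv ℝ (φ ∘ ψ) =ᶠ[𝓝 a]
      fun z => (fderiv ℝ φ (ψ z)).comp ((fderiv ℂ ψ z).restrictScalars ℝ) := by
    have h1 : ∀ᶠ z in 𝓝 a, ContDiffAt ℝ 2 φ (ψ z) := hψc.eventually (hφ.eventually (by simp))
    have h2 : ∀ᶠ z in 𝓝 a, ContDiffAt ℂ 2 ψ z := hψ.eventually (by simp)
    filter_upwards [h1, h2] with z hz1 hz2
    exact ((hz1.differentiableAt (by simp)).hasFDerivAt.comp z
      ((hz2.differentiableAt (by simp)).hasFDerivAt.restrictScalars ℝ)).fderiv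
  have hDφ : HasFDerivAt (fderiv ℝ φ) (fderiv ℝ (fderiv ℝ φ) (ψ a)) (ψ a) :=
    ((hφ.fderiv_right (m := 1) (by norm_num)).differentiableAt (by simp)).hasFDerivAt
  have hDψ : HasFDerivAt (fderiv ℂ ψ) (fderiv ℂ (fderiv ℂ ψ) a) a :=
    ((hψ.fderiv_right (m := 1) (by norm_num)).differentiableAt (by simp)).hasFDerivAt
  have hψ' : HasFDerivAt ψ ((fderiv ℂ ψ a).restrictScalars ℝ) a :=
    (hψ.differentiableAt (by simp)).hasFDerivAt.restrictScalars ℝ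
  have hDψ' : HasFDerivAt (fun z => (fderiv ℂ ψ z).restrictScalars ℝ)
      ((ContinuousLinearMap.restrictScalarsL ℂ E F ℝ ℝ).comp
        ((fderiv ℂ (fderiv ℂ ψ) a).restrictScalars ℝ)) a :=
    (ContinuousLinearMap.restrictScalarsL ℂ E F ℝ ℝ).hasFDerivAt.comp a (hDψ.restrictScalars ℝ)
  have h := HasFDerivAt.fderiv ((hDφ.comp a hψ').clm_comp hDψ')
  simp only [Function.comp_apply] at h
  rw [hev.fderiv_eq, h]
  simp [add_comm]

end Levi

section LeviForm

open scoped Topology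
open Filter

variable {d d' : ℕ}

theorem leviFun_congr {φ φ' : Cn d → ℝ} {a : Cn d} (h : φ =ᶠ[𝓝 a] φ') (u v : Cn d) :
    leviFun φ a u v = leviFun φ' a u v := by
  simp only [leviFun, h.fderiv.fderiv_eq]

theorem leviFun_add {φ φ' : Cn d → ℝ} {a : Cn d} (hφ : ContDiffAt ℝ 2 φ a)
    (hφ' : ContDiffAt ℝ 2 φ' a) (u v : Cn d) :
    leviFun (fun z => φ z + φ' z) a u v = leviFun φ a u v + leviFun φ' a u v := by
  have hev : fderiv ℝ (fun z => φ z + φ' z) =ᶠ[𝓝 a] fun z => fderiv ℝ φ z + fderiv ℝ φ' z := by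
    filter_upwards [hφ.eventually (by simp), hφ'.eventually (by simp)] with z hz hz'
    exact fderiv_fun_add (hz.differentiableAt (by simp)) (hz'.differentiableAt (by simp))
  have h : fderiv ℝ (fderiv ℝ (fun z => φ z + φ' z)) a =
      fderiv ℝ (fderiv ℝ φ) a + fderiv ℝ (fderiv ℝ φ') a := by
    rw [hev.fderiv_eq]
    exact fderiv_fun_add ((hφ.fderiv_right (m := 1) (by norm_num)).differentiableAt (by simp))
      ((hφ'.fderiv_right (m := 1) (by norm_num)).differentiableAt (by simp))
  simp only [leviFun, h, add_apply]
  push_cast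
  ring

/-- The complex Hessian transforms as a sesquilinear form under holomorphic maps: the second
derivative of the map is complex bilinear, hence does not contribute. -/
theorem leviFun_comp_holomorphic {φ : Cn d' → ℝ} {ψ : Cn d → Cn d'} {a : Cn d}
    (hφ : ContDiffAt ℝ 2 φ (ψ a)) (hψ : ContDiffAt ℂ 2 ψ a) (u v : Cn d) :
    leviFun (φ ∘ ψ) a u v = leviFun φ (ψ a) (fderiv ℂ ψ a u) (fderiv ℂ ψ a v) := by
  have hII : ∀ w : Cn d', I • I • w = -w := fun w => by rw [smul_smul, I_mul_I, neg_one_smul]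
  simp only [leviFun, fderiv_fderiv_comp_holomorphic hφ hψ, map_smul,
    smul_apply, hII, map_neg]
  push_cast
  ring

theorem leviFun_re_holomorphic {f : Cn d → ℂ} {a : Cn d} (hf : ContDiffAt ℂ 2 f a)
    (u v : Cn d) : leviFun (fun z => (f z).re) a u v = 0 := by
  have hre : ContDiffAt ℝ 2 (fun z : ℂ => z.re) (f a) := reCLM.contDiff.contDiffAt
  have h0 : fderiv ℝ (fderiv ℝ fun z : ℂ => z.re) (f a) = 0 := by
    have : (fderiv ℝ fun z : ℂ => z.re) = fun _ => reCLM := by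
      ext1 z
      exact reCLM.hasFDerivAt.fderiv
    rw [this]
    simp
  have hII : ∀ w : ℂ, I • I • w = -w := fun w => by rw [smul_smul, I_mul_I, neg_one_smul]
  have h := fderiv_fderiv_comp_holomorphic hre hf
  simp only [leviFun]
  change ((((fderiv ℝ (fderiv ℝ ((fun z : ℂ => z.re) ∘ f)) a u) v +
    (fderiv ℝ (fderiv ℝ ((fun z : ℂ => z.re) ∘ f)) a (I • u)) (I • v) : ℝ) : ℂ) +
    I * (((fderiv ℝ (fderiv ℝ ((fun z : ℂ => z.re) ∘ f)) a u) (I • v) -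
    (fderiv ℝ (fderiv ℝ ((fun z : ℂ => z.re) ∘ f)) a (I • u)) v : ℝ) : ℂ)) / 4 = 0
  simp only [h, h0, map_smul, smul_apply, hII, map_neg,
    zero_apply]
  simp

theorem contDiffAt_log_normSq {g : Cn d → ℂ} {a : Cn d} {n : WithTop ℕ∞}
    (hg : ContDiffAt ℝ n g a) (h0 : g a ≠ 0) :
    ContDiffAt ℝ n (fun z => Real.log (normSq (g z))) a := by
  have h1 : ContDiffAt ℝ n (fun z => normSq (g z)) a := by
    simp only [normSq_apply]
    have hre := reCLM.contDiff.contDiffAt.comp a hg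
    have him := imCLM.contDiff.contDiffAt.comp a hg
    exact (hre.mul hre).add (him.mul him)
  exact h1.log (normSq_pos.2 h0).ne'

/-- The function `log |g|²` is pluriharmonic for a nowhere vanishing holomorphic function `g`. -/
theorem leviFun_log_normSq_holomorphic {g : Cn d → ℂ} {a : Cn d} (hg : ContDiffAt ℂ 2 g a)
    (h0 : g a ≠ 0) (u v : Cn d) : leviFun (fun z => Real.log (normSq (g z))) a u v = 0 := by
  have hq : ContDiffAt ℂ 2 (fun z => g z / g a) a := hg.div_const _
  have h1 : g a / g a = 1 := div_self h0
  have hslit : g a / g a ∈ slitPlane := by rw [h1]; exact one_mem_slitPlane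
  have hF : ContDiffAt ℂ 2
      (fun z => 2 * Complex.log (g z / g a) + (Real.log (normSq (g a)) : ℂ)) a :=
    (contDiffAt_const.mul ((contDiffAt_log hslit).comp a hq)).add contDiffAt_const
  rw [← leviFun_re_holomorphic hF u v]
  refine leviFun_congr ?_ u v
  filter_upwards [hg.continuousAt.eventually_ne h0] with z hz
  rw [add_re, ofReal_re, mul_re]
  simp only [log_re, re_ofNat, im_ofNat, zero_mul, sub_zero]
  have hz' : ‖g z‖ ≠ 0 := norm_ne_zero_iff.2 hz
  have h0' : ‖g a‖ ≠ 0 := norm_ne_zero_iff.2 h0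
  rw [normSq_eq_norm_sq, normSq_eq_norm_sq, norm_div, Real.log_div hz' h0', Real.log_pow,
    Real.log_pow]
  push_cast
  ring

end LeviForm

/-! ### The underlying real manifold -/

section RealStructure

variable {d : ℕ} {X : Type*} [TopologicalSpace X] [ChartedSpace (Cn d) X]

theorem contDiffOn_chart_transition [IsManifold 𝓘(ℂ, Cn d) ω X]
    {e e' : OpenPartialHomeomorph X (Cn d)}
    (he : e ∈ atlas (Cn d) X) (he' : e' ∈ atlas (Cn d) X) :
    ContDiffOn ℂ ω (e.symm ≫ₕ e') (e.symm ≫ₕ e').source := by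
  have h := HasGroupoid.compatible (G := contDiffGroupoid ω 𝓘(ℂ, Cn d)) he he'
  have := (mem_groupoid_of_pregroupoid.1 h).1
  simpa [contDiffPregroupoid] using this

/-- A complex manifold is a smooth real manifold. -/
theorem isManifold_real [IsManifold 𝓘(ℂ, Cn d) ω X] : IsManifold 𝓘(ℝ, Cn d) ∞ X := by
  refine isManifold_of_contDiffOn _ _ _ fun e e' he he' => ?_
  have h := ((contDiffOn_chart_transition he he').restrict_scalars ℝ).of_le
    (m := (∞ : WithTop ℕ∞)) le_top
  simpa using h

theorem ContMDiffAt.restrictScalars_real {F : Type*} [NormedAddCommGroup F] [NormedSpace ℂ F]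
    [NormedSpace ℝ F] [IsScalarTower ℝ ℂ F] {f : X → F} {x : X} {n : WithTop ℕ∞}
    (hf : ContMDiffAt 𝓘(ℂ, Cn d) 𝓘(ℂ, F) n f x) : ContMDiffAt 𝓘(ℝ, Cn d) 𝓘(ℝ, F) n f x := by
  rw [contMDiffAt_iff] at hf ⊢
  exact ⟨hf.1, hf.2.restrict_scalars ℝ⟩

end RealStructure

/-! ### The curvature in a fixed chart and frame -/

section Curvature

open scoped Topology
open Filter

variable {d : ℕ} {X : Type*} [TopologicalSpace X] [ChartedSpace (Cn d) X]
  {L : X → Type*} [TopologicalSpace (TotalSpace ℂ L)] [∀ x, TopologicalSpace (L x)]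
  [∀ x, AddCommGroup (L x)] [∀ x, Module ℂ (L x)] [FiberBundle ℂ L] [VectorBundle ℂ ℂ L]

theorem leviForm_apply (φ : Cn d → ℝ) (a u v : Cn d) : leviForm φ a u v = leviFun φ a u v := rfl

theorem localFrameAt_ne_zero {x y : X} (hy : y ∈ (trivializationAt ℂ L x).baseSet) :
    (localFrameAt x y : L y) ≠ 0 := by
  intro h0
  have h := congrArg (fun s => (trivializationAt ℂ L x).continuousLinearMapAt ℂ y s) h0
  simp only [localFrameAt, map_zero] at h
  rw [← Trivialization.symmL_apply (R := ℂ) _ hy, Trivialization.continuousLinearMapAt_symmL _ hy] at h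
  exact one_ne_zero h

theorem localWeight_eq (h : HermitianMetric d ℂ L) {x₀ y : X} {z : Cn d}
    (hz : (chartAt (Cn d) x₀).symm z = y) :
    localWeight h x₀ z = -Real.log (h.form y (localFrameAt x₀ y) (localFrameAt x₀ y)).re := by
  subst hz
  rfl

theorem contDiffAt_localWeight [IsManifold 𝓘(ℂ, Cn d) ω X] (h : HermitianMetric d ℂ L)
    {x₀ x : X} (hx : x ∈ (chartAt (Cn d) x₀).source)
    (hxL : x ∈ (trivializationAt ℂ L x₀).baseSet) :
    ContDiffAt ℝ ∞ (localWeight h x₀) (chartAt (Cn d) x₀ x) := by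
  have := isManifold_real (X := X) (d := d)
  have hs := h.smooth (trivializationAt ℂ L x₀) 1 1
  have hs' : ContMDiffAt 𝓘(ℝ, Cn d) 𝓘(ℝ, ℂ) ∞
      (fun y => h.form y (localFrameAt x₀ y) (localFrameAt x₀ y)) x :=
    hs.contMDiffAt ((trivializationAt ℂ L x₀).open_baseSet.mem_nhds hxL)
  have hz : chartAt (Cn d) x₀ x ∈ (chartAt (Cn d) x₀).target := (chartAt (Cn d) x₀).map_source hx
  have hsymm : ContMDiffAt 𝓘(ℝ, Cn d) 𝓘(ℝ, Cn d) ∞ (chartAt (Cn d) x₀).symm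
      (chartAt (Cn d) x₀ x) :=
    (contMDiffOn_chart_symm (I := 𝓘(ℝ, Cn d)) (n := ∞) (x := x₀)).contMDiffAt
      ((chartAt (Cn d) x₀).open_target.mem_nhds hz)
  have hinv : (chartAt (Cn d) x₀).symm (chartAt (Cn d) x₀ x) = x :=
    (chartAt (Cn d) x₀).left_inv hx
  have hcomp := ContMDiffAt.comp (chartAt (Cn d) x₀ x) (by rw [hinv]; exact hs') hsymm
  have hre := reCLM.contDiff.contDiffAt.comp _ (contMDiffAt_iff_contDiffAt.1 hcomp)
  refine ((hre.log ?_).neg : _)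
  simp only [Function.comp_apply, reCLM_apply]
  rw [hinv]
  exact (h.pos x _ (localFrameAt_ne_zero hxL)).ne'

theorem contDiffAt_chart_comp_chart_symm [IsManifold 𝓘(ℂ, Cn d) ω X] {x₀ x : X}
    (hx : x ∈ (chartAt (Cn d) x₀).source) :
    ContDiffAt ℂ ω (chartAt (Cn d) x₀ ∘ (chartAt (Cn d) x).symm) (chartAt (Cn d) x x) := by
  refine (contDiffOn_chart_transition (chart_mem_atlas (Cn d) x)
    (chart_mem_atlas (Cn d) x₀)).contDiffAt (IsOpen.mem_nhds (OpenPartialHomeomorph.open_source _) ?_)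
  simp [hx]

/-- The transition function between the preferred frames at `x` and at `x₀`, evaluated at `y`. -/
def frameTransition (L : X → Type*) [TopologicalSpace (TotalSpace ℂ L)]
    [∀ x, TopologicalSpace (L x)] [∀ x, AddCommGroup (L x)] [∀ x, Module ℂ (L x)]
    [FiberBundle ℂ L] [VectorBundle ℂ ℂ L] (x x₀ y : X) : ℂ :=
  Trivialization.coordChangeL ℂ (trivializationAt ℂ L x) (trivializationAt ℂ L x₀) y 1

theorem localFrameAt_eq_smul {x x₀ y : X} (hy : y ∈ (trivializationAt ℂ L x).baseSet)
    (hy₀ : y ∈ (trivializationAt ℂ L x₀).baseSet) :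
    (localFrameAt x y : L y) = frameTransition L x x₀ y • localFrameAt x₀ y := by
  simp only [localFrameAt, frameTransition]
  rw [← Trivialization.symmL_apply (R := ℂ) _ hy₀, ← map_smul, smul_eq_mul, mul_one,
    Trivialization.coordChangeL_apply _ _ ⟨hy, hy₀⟩,
    ← Trivialization.continuousLinearMapAt_apply_of_mem ℂ _ hy₀,
    Trivialization.symmL_continuousLinearMapAt _ hy₀]

theorem frameTransition_ne_zero {x x₀ y : X} (hy : y ∈ (trivializationAt ℂ L x).baseSet)
    (hy₀ : y ∈ (trivializationAt ℂ L x₀).baseSet) : frameTransition L x x₀ y ≠ 0 := by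
  intro h0
  have := localFrameAt_eq_smul (L := L) hy hy₀
  rw [h0, zero_smul] at this
  exact localFrameAt_ne_zero hy this

/-- The curvature at `x`, as a sesquilinear form on the model space, to which the tangent space is
identified by the preferred chart at `x`. -/
def coordCurvature (h : HermitianMetric d ℂ L) (x : X) : Sesq (Cn d) := curvature h x

/-- The curvature is independent of the chart and of the holomorphic frame used to compute it. -/
theorem coordCurvature_eq_leviFun [IsManifold 𝓘(ℂ, Cn d) ω X] [ContMDiffVectorBundle ω ℂ L 𝓘(ℂ, Cn d)]
    (h : HermitianMetric d ℂ L) {x₀ x : X} (hx : x ∈ (chartAt (Cn d) x₀).source)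
    (hxL : x ∈ (trivializationAt ℂ L x₀).baseSet) (u v : Cn d) :
    coordCurvature h x u v = leviFun (localWeight h x₀) (chartAt (Cn d) x₀ x)
      (tangentCoordChange 𝓘(ℂ, Cn d) x x₀ x u) (tangentCoordChange 𝓘(ℂ, Cn d) x x₀ x v) := by
  set ψ := chartAt (Cn d) x₀ ∘ (chartAt (Cn d) x).symm with hψdef
  set z := chartAt (Cn d) x x with hz
  have hxx : x ∈ (chartAt (Cn d) x).source := mem_chart_source _ x
  have hxxL : x ∈ (trivializationAt ℂ L x).baseSet := mem_baseSet_trivializationAt ℂ L x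
  have hinv : (chartAt (Cn d) x).symm z = x := (chartAt (Cn d) x).left_inv hxx
  have hψ : ContDiffAt ℂ ω ψ z := contDiffAt_chart_comp_chart_symm hx
  have hψz : ψ z = chartAt (Cn d) x₀ x := by simp only [hψdef, Function.comp_apply, hinv]
  have hD : tangentCoordChange 𝓘(ℂ, Cn d) x x₀ x = fderiv ℂ ψ z := by
    rw [tangentCoordChange_def]
    simp [hψdef, hz]
  have hsymm : ContMDiffAt 𝓘(ℂ, Cn d) 𝓘(ℂ, Cn d) ω (chartAt (Cn d) x).symm z :=
    (contMDiffOn_chart_symm (I := 𝓘(ℂ, Cn d)) (n := ω) (x := x)).contMDiffAt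
      ((chartAt (Cn d) x).open_target.mem_nhds ((chartAt (Cn d) x).map_source hxx))
  let g : Cn d → ℂ := fun z' => frameTransition L x x₀ ((chartAt (Cn d) x).symm z')
  have hg : ContDiffAt ℂ ω g z := by
    have h1 := contMDiffOn_coordChangeL (n := ω) (IB := 𝓘(ℂ, Cn d)) (trivializationAt ℂ L x)
      (trivializationAt ℂ L x₀)
    have h2 := h1.contMDiffAt (x := x) ((((trivializationAt ℂ L x).open_baseSet).inter
      ((trivializationAt ℂ L x₀).open_baseSet)).mem_nhds ⟨hxxL, hxL⟩)
    have h3 := ContMDiffAt.comp z (by rw [hinv]; exact h2) hsymm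
    exact (contMDiffAt_iff_contDiffAt.1 h3).clm_apply contDiffAt_const
  have hg0 : g z ≠ 0 := by
    simp only [g, hinv]; exact frameTransition_ne_zero hxxL hxL
  have hφ : ContDiffAt ℝ 2 (localWeight h x₀) (ψ z) := by
    rw [hψz]
    exact (contDiffAt_localWeight h hx hxL).of_le (by norm_cast)
  have hlog : ContDiffAt ℝ 2 (fun z => Real.log (normSq (g z))) z :=
    contDiffAt_log_normSq ((hg.restrict_scalars ℝ).of_le le_top) hg0
  have hev : localWeight h x =ᶠ[𝓝 z]
      fun z' => (localWeight h x₀ ∘ ψ) z' + -(Real.log (normSq (g z'))) := by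
    have hc : ContinuousAt (chartAt (Cn d) x).symm z := hsymm.continuousAt
    have hn : ∀ s : Set X, IsOpen s → x ∈ s → ∀ᶠ z' in 𝓝 z, (chartAt (Cn d) x).symm z' ∈ s :=
      fun s hs hxs => hc.eventually (by rw [hinv]; exact hs.mem_nhds hxs)
    filter_upwards [hn _ (trivializationAt ℂ L x).open_baseSet hxxL,
      hn _ (trivializationAt ℂ L x₀).open_baseSet hxL,
      hn _ (chartAt (Cn d) x₀).open_source hx] with z' h1 h2 h3
    simp only [hψdef, Function.comp_apply, g]
    rw [localWeight_eq h ((chartAt (Cn d) x₀).left_inv h3)]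
    simp only [localWeight]
    rw [localFrameAt_eq_smul h1 h2, LinearMap.map_smul,
      LinearMap.smul_apply, LinearMap.map_smulₛₗ, smul_smul, Complex.mul_conj, smul_eq_mul, re_ofReal_mul, Real.log_mul
        (normSq_pos.2 (frameTransition_ne_zero h1 h2)).ne'
        (h.pos _ _ (localFrameAt_ne_zero h2)).ne']
    ring
  have hlog0 : leviFun (fun z' => -(Real.log (normSq (g z')))) z u v = 0 := by
    have h1 := leviFun_log_normSq_holomorphic (hg.inv hg0 |>.of_le le_top) (inv_ne_zero hg0) u v
    simpa [Complex.normSq_inv, Real.log_inv] using h1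
  change leviFun (localWeight h x) z u v = _
  rw [leviFun_congr hev, leviFun_add (hφ.comp z ((hψ.restrict_scalars ℝ).of_le le_top)) hlog.neg,
    hlog0, add_zero, leviFun_comp_holomorphic hφ (hψ.of_le le_top), hψz, hD]

end Curvature

/-! ### The local estimate -/

section LocalEstimate

open scoped Topology InnerProductSpace
open Filter

/-- If `f > 0` on the zero set of `N ≥ 0` in a compact set, then `f + K N - δ M > 0` there for some
`K` and `δ`. -/
theorem IsCompact.exists_pos_add_mul_sub_mul {α : Type*} [TopologicalSpace α] {S : Set α}
    (hS : IsCompact S) {f N M : α → ℝ} (hf : Continuous f) (hN : Continuous N) (hM : Continuous M)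
    (hN0 : ∀ s, 0 ≤ N s) (hpos : ∀ s ∈ S, N s = 0 → 0 < f s) :
    ∃ K > 0, ∃ δ > 0, ∀ s ∈ S, 0 < f s + K * N s - δ * M s := by
  obtain ⟨c, hc, hcN⟩ := (hS.inter_right (isClosed_Iic.preimage hf : IsClosed (f ⁻¹' Set.Iic 0)))
    |>.exists_forall_le' (a := 0) hN.continuousOn (fun s hs => (hN0 s).lt_of_ne fun h =>
      (hpos s hs.1 h.symm).not_ge hs.2)
  obtain ⟨b, hb⟩ := hS.bddBelow_image hf.continuousOn
  have hb' : ∀ s ∈ S, -|b| ≤ f s := fun s hs =>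
    (neg_abs_le b).trans (hb (Set.mem_image_of_mem f hs))
  have hK : 0 < (|b| + 1) / c := by positivity
  have h1 : ∀ s ∈ S, 0 < f s + (|b| + 1) / c * N s := by
    intro s hs
    by_cases hfs : f s ≤ 0
    · have h2 : (|b| + 1) / c * c ≤ (|b| + 1) / c * N s :=
        mul_le_mul_of_nonneg_left (hcN s ⟨hs, hfs⟩) hK.le
      rw [div_mul_cancel₀ _ hc.ne'] at h2
      linarith [hb' s hs]
    · have := mul_nonneg hK.le (hN0 s)
      linarith [not_le.1 hfs]
  obtain ⟨μ, hμ, hμf⟩ := hS.exists_forall_le' (a := 0)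
    (f := fun s => f s + (|b| + 1) / c * N s) (by fun_prop) h1
  obtain ⟨b', hb'⟩ := hS.bddAbove_image hM.continuousOn
  refine ⟨_, hK, μ / (|b'| + 1), by positivity, fun s hs => ?_⟩
  have h3 : M s < |b'| + 1 :=
    ((hb' (Set.mem_image_of_mem M hs)).trans (le_abs_self b')).trans_lt (lt_add_one _)
  have h4 : μ / (|b'| + 1) * M s < μ / (|b'| + 1) * (|b'| + 1) :=
    mul_lt_mul_of_pos_left h3 (by positivity)
  rw [div_mul_cancel₀ _ (by positivity)] at h4
  have := hμf s hs
  linarith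

variable {d m : ℕ} {X : Type*} [TopologicalSpace X] [ChartedSpace (Cn d) X]
  {Y : Type*} [TopologicalSpace Y] [ChartedSpace (Cn m) Y]
  {L : X → Type*} [TopologicalSpace (TotalSpace ℂ L)] [∀ x, TopologicalSpace (L x)]
  [∀ x, AddCommGroup (L x)] [∀ x, Module ℂ (L x)] [FiberBundle ℂ L] [VectorBundle ℂ ℂ L]

/-- The derivative of `p` at `x` in the preferred charts at `x` and at `p x`. -/
def coordDeriv (p : X → Y) (x : X) : Cn d →L[ℂ] Cn m :=
  mfderiv 𝓘(ℂ, Cn d) 𝓘(ℂ, Cn m) p x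

/-- The quadratic form `Q + K |w - ⟨v, w⟩ v|² - δ |⟨v, w⟩|²` in `u`, with `w = A u`. -/
def defectForm (v : Cn m) (K δ : ℝ) (q : Cn d → ℂ) (A : Cn d →L[ℂ] Cn m) (u : Cn d) : ℝ :=
  (q u).re + K * ‖A u - ⟪v, A u⟫_ℂ • v‖ ^ 2 - δ * ‖⟪v, A u⟫_ℂ‖ ^ 2

theorem defectForm_smul (v : Cn m) (K δ : ℝ) (H : Sesq (Cn d)) (A : Cn d →L[ℂ] Cn m) (c : ℂ)
    (u : Cn d) : defectForm v K δ (fun u => H u u) A (c • u) =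
      ‖c‖ ^ 2 * defectForm v K δ (fun u => H u u) A u := by
  simp only [defectForm, map_smul, inner_smul_right, mul_smul, ← smul_sub, norm_smul, norm_mul,
    LinearMap.map_smulₛₗ, LinearMap.smul_apply, smul_eq_mul]
  rw [mul_left_comm, ← mul_assoc, Complex.mul_conj, re_ofReal_mul, normSq_eq_norm_sq]
  ring

theorem defectForm_nonneg {v : Cn m} {K δ : ℝ} {H : Sesq (Cn d)} {A : Cn d →L[ℂ] Cn m}
    (h : ∀ u ∈ Metric.sphere (0 : Cn d) 1, 0 < defectForm v K δ (fun u => H u u) A u) (u : Cn d) :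
    0 ≤ defectForm v K δ (fun u => H u u) A u := by
  rcases eq_or_ne u 0 with rfl | hu
  · simp [defectForm]
  · have hu' : u = (‖u‖ : ℂ) • ((‖u‖ : ℂ)⁻¹ • u) := by
      rw [smul_smul, mul_inv_cancel₀ (by simpa using hu), one_smul]
    rw [hu', defectForm_smul]
    refine mul_nonneg (by positivity) (h _ ?_).le
    rw [mem_sphere_zero_iff_norm, norm_smul, norm_inv, norm_real, norm_norm,
      inv_mul_cancel₀ (norm_ne_zero_iff.2 hu)]

theorem eventually_estimate [IsManifold 𝓘(ℂ, Cn d) ω X] [IsManifold 𝓘(ℂ, Cn m) ω Y]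
    [ContMDiffVectorBundle ω ℂ L 𝓘(ℂ, Cn d)] {p : X → Y}
    (hp : ContMDiff 𝓘(ℂ, Cn d) 𝓘(ℂ, Cn m) ω p) (h : HermitianMetric d ℂ L) (x₀ : X)
    (hfib : ∀ u : Cn d, u ≠ 0 → coordDeriv (m := m) p x₀ u = 0 →
      0 < (coordCurvature h x₀ u u).re)
    {v : Cn m} (hv : ∀ u : Cn d, coordDeriv (m := m) p x₀ u = v →
      0 < (coordCurvature h x₀ u u).re) :
    ∃ K > 0, ∃ δ > 0, ∀ᶠ x in 𝓝 x₀, ∀ u : Cn d, 0 ≤ defectForm v K δ (fun u => coordCurvature h x u u)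
      ((tangentCoordChange 𝓘(ℂ, Cn m) (p x) (p x₀) (p x)).comp
        (coordDeriv p x)) u := by
  let A : X → Cn d →L[ℂ] Cn m := inTangentCoordinates 𝓘(ℂ, Cn d) 𝓘(ℂ, Cn m) id p
    (coordDeriv p) x₀
  let φ := localWeight h x₀
  let c := chartAt (Cn d) x₀
  have hx₀ : x₀ ∈ c.source := mem_chart_source _ x₀
  have hx₀L := mem_baseSet_trivializationAt ℂ L x₀
  have hA : ContinuousAt A x₀ :=
    ((hp x₀).mfderiv_const (m := 0) (by simp)).continuousAt
  -- at `x₀` itself, the coordinate expressions are the intrinsic objects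
  have hA₀ : A x₀ = (coordDeriv p x₀) := by
    change inTangentCoordinates 𝓘(ℂ, Cn d) 𝓘(ℂ, Cn m) id p (coordDeriv p) x₀ x₀ = _
    rw [inTangentCoordinates_eq id p (coordDeriv p) (mem_chart_source _ (id x₀)) (mem_chart_source _ (p x₀))]
    ext1 u
    have h1 := tangentCoordChange_self (I := 𝓘(ℂ, Cn d)) (x := x₀) (z := x₀) (v := u)
      (mem_extChartAt_source x₀)
    have h2 := fun v => tangentCoordChange_self (I := 𝓘(ℂ, Cn m)) (x := p x₀) (z := p x₀) (v := v)
      (mem_extChartAt_source (p x₀))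
    exact (h2 _).trans (congrArg _ h1)
  have hS : IsCompact (Metric.sphere (0 : Cn d) 1) := isCompact_sphere _ _
  have hD2 : ContinuousAt (fun z => fderiv ℝ (fderiv ℝ φ) z) (c x₀) := by
    have h1 : ContDiffAt ℝ ∞ φ (c x₀) := contDiffAt_localWeight h hx₀ hx₀L
    have h2 : ContDiffAt ℝ 1 (fderiv ℝ φ) (c x₀) := h1.fderiv_right (by norm_cast)
    exact (h2.fderiv_right (m := 0) (by norm_num)).continuousAt
  have hlevi : ∀ u₀ : Cn d, ContinuousAt (fun q : X × Cn d => leviFun φ (c q.1) q.2 q.2)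
      (x₀, u₀) := by
    intro u₀
    have h1 : ContinuousAt (fun q : X × Cn d => fderiv ℝ (fderiv ℝ φ) (c q.1)) (x₀, u₀) :=
      ContinuousAt.comp (f := fun q : X × Cn d => c q.1) (x := (x₀, u₀)) hD2
        (ContinuousAt.comp (f := Prod.fst) (x := (x₀, u₀)) (c.continuousAt hx₀) continuousAt_fst)
    have h2 : ContinuousAt (fun q : X × Cn d => q.2) (x₀, u₀) := continuousAt_snd
    have h3 : ContinuousAt (fun q : X × Cn d => I • q.2) (x₀, u₀) := h2.const_smul I
    have hDD : ∀ {a b : X × Cn d → Cn d}, ContinuousAt a (x₀, u₀) → ContinuousAt b (x₀, u₀) →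
        ContinuousAt (fun q => fderiv ℝ (fderiv ℝ φ) (c q.1) (a q) (b q)) (x₀, u₀) :=
      fun ha hb => (h1.clm_apply ha).clm_apply hb
    simp only [leviFun]
    exact ((continuous_ofReal.continuousAt.comp ((hDD h2 h2).add (hDD h3 h3))).add
      (continuousAt_const.mul
        (continuous_ofReal.continuousAt.comp ((hDD h2 h3).sub (hDD h3 h2))))).div_const 4
  have hlevi₀ : Continuous fun u : Cn d => leviFun φ (c x₀) u u :=
    continuous_iff_continuousAt.2 fun u₀ =>
      (hlevi u₀).comp (f := fun u => (x₀, u)) (by fun_prop)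
  have hcurv₀ : ∀ u : Cn d, leviFun φ (c x₀) u u = coordCurvature h x₀ u u := fun u => rfl
  obtain ⟨K, hK, δ, hδ, hpos⟩ := hS.exists_pos_add_mul_sub_mul
    (f := fun u => (leviFun φ (c x₀) u u).re)
    (N := fun u => ‖A x₀ u - ⟪v, A x₀ u⟫_ℂ • v‖ ^ 2) (M := fun u => ‖⟪v, A x₀ u⟫_ℂ‖ ^ 2)
    (continuous_re.comp hlevi₀) (by fun_prop) (by fun_prop) (fun _ => by positivity) (by
      intro u hu hN
      have hu0 : u ≠ 0 := by
        rintro rfl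
        simp at hu
      rw [hA₀, sq_eq_zero_iff, norm_eq_zero, sub_eq_zero] at hN
      simp only [hcurv₀]
      set s : ℂ := ⟪v, (coordDeriv p x₀) u⟫_ℂ
      by_cases hs : s = 0
      · rw [hs, zero_smul] at hN
        exact hfib u hu0 hN
      · have h1 := hv (s⁻¹ • u) (by
          refine (map_smul (coordDeriv p x₀) s⁻¹ u).trans ?_
          rw [hN, smul_smul, inv_mul_cancel₀ hs, one_smul])
        have h2 : coordCurvature h x₀ (s⁻¹ • u) (s⁻¹ • u) =
            s⁻¹ * ((starRingEnd ℂ) s⁻¹ * coordCurvature h x₀ u u) := by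
          change leviForm φ (c x₀) (s⁻¹ • u) (s⁻¹ • u) =
            s⁻¹ * ((starRingEnd ℂ) s⁻¹ * leviForm φ (c x₀) u u)
          rw [LinearMap.map_smul, LinearMap.smul_apply, LinearMap.map_smulₛₗ, smul_eq_mul,
            smul_eq_mul]
        erw [h2] at h1
        rw [← mul_assoc, Complex.mul_conj, re_ofReal_mul] at h1
        exact (pos_iff_pos_of_mul_pos h1).1 (normSq_pos.2 (inv_ne_zero hs)))
  refine ⟨K, hK, δ, hδ, ?_⟩
  have hcont : ∀ u₀ : Cn d, ContinuousAt
      (fun q : X × Cn d => defectForm v K δ (fun u => leviForm φ (c q.1) u u) (A q.1) q.2)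
      (x₀, u₀) := by
    intro u₀
    have h1 : ContinuousAt (fun q : X × Cn d => A q.1 q.2) (x₀, u₀) :=
      (ContinuousAt.comp (f := Prod.fst) (x := (x₀, u₀)) hA continuousAt_fst).clm_apply
        continuousAt_snd
    have h2 : ContinuousAt (fun q : X × Cn d => ⟪v, A q.1 q.2⟫_ℂ) (x₀, u₀) :=
      ContinuousAt.inner (𝕜 := ℂ) continuousAt_const h1
    exact ((continuous_re.continuousAt.comp (hlevi u₀)).add
      (continuousAt_const.mul ((h1.sub (h2.smul continuousAt_const)).norm.pow 2))).sub
      (continuousAt_const.mul (h2.norm.pow 2))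
  have hev := hS.eventually_forall_of_forall_eventually (x₀ := x₀)
    (P := fun x u => 0 < defectForm v K δ (fun u => leviForm φ (c x) u u) (A x) u)
    (fun u₀ hu₀ => (hcont u₀).eventually (lt_mem_nhds (hpos u₀ hu₀)))
  filter_upwards [hev, c.open_source.mem_nhds hx₀,
    (trivializationAt ℂ L x₀).open_baseSet.mem_nhds hx₀L,
    hp.continuous.continuousAt.preimage_mem_nhds
      ((chartAt (Cn m) (p x₀)).open_source.mem_nhds (mem_chart_source _ (p x₀)))]
    with x hx hxc hxL hxp u
  have h1 := defectForm_nonneg hx (tangentCoordChange 𝓘(ℂ, Cn d) x x₀ x u)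
  have h2 : A x (tangentCoordChange 𝓘(ℂ, Cn d) x x₀ x u) =
      (tangentCoordChange 𝓘(ℂ, Cn m) (p x) (p x₀) (p x)).comp
        (coordDeriv p x) u := by
    change inTangentCoordinates 𝓘(ℂ, Cn d) 𝓘(ℂ, Cn m) id p (coordDeriv p) x₀ x _ = _
    rw [inTangentCoordinates_eq id p (coordDeriv p) (x₀ := x₀) (x := x) hxc hxp]
    have h3 := tangentCoordChange_comp (I := 𝓘(ℂ, Cn d)) (w := x) (x := x₀) (y := x) (z := x)
      (v := u) (by simpa using hxc)
    rw [tangentCoordChange_self (mem_extChartAt_source x)] at h3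
    simp only [ContinuousLinearMap.comp_apply, id]
    congr 2
  simp only [defectForm, h2, leviForm_apply] at h1
  simp only [defectForm, coordCurvature_eq_leviFun h hxc hxL]
  exact h1

end LocalEstimate

/-! ### Positivity near a fibre -/

section FibreEstimate

open scoped Topology InnerProductSpace
open Filter

variable {d m : ℕ} {X : Type*} [TopologicalSpace X] [ChartedSpace (Cn d) X]
  {Y : Type*} [TopologicalSpace Y] [ChartedSpace (Cn m) Y]
  {L : X → Type*} [TopologicalSpace (TotalSpace ℂ L)] [∀ x, TopologicalSpace (L x)]
  [∀ x, AddCommGroup (L x)] [∀ x, Module ℂ (L x)] [FiberBundle ℂ L] [VectorBundle ℂ ℂ L]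

theorem defectForm_mono (v : Cn m) {K K' δ δ' : ℝ} (hK : K ≤ K') (hδ : δ' ≤ δ) (q : Cn d → ℂ)
    (A : Cn d →L[ℂ] Cn m) (u : Cn d) : defectForm v K δ q A u ≤ defectForm v K' δ' q A u := by
  simp only [defectForm]
  gcongr

theorem tangentMap_eq_of_coordDeriv_eq {p : X → Y} {x : X} {t : Y} (hx : p x = t) {u : Cn d}
    {v : Cn m} (hu : coordDeriv p x u = v) :
    tangentMap 𝓘(ℂ, Cn d) 𝓘(ℂ, Cn m) p ⟨x, u⟩ = ⟨t, v⟩ := by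
  subst hx
  subst hu
  rfl

/-- The estimate of `eventually_estimate` is uniform over a compact fibre, hence holds over a
neighbourhood of its image, because proper maps are closed. -/
theorem eventually_fiber_estimate [IsManifold 𝓘(ℂ, Cn d) ω X] [IsManifold 𝓘(ℂ, Cn m) ω Y]
    [ContMDiffVectorBundle ω ℂ L 𝓘(ℂ, Cn d)] {p : X → Y}
    (hp : ContMDiff 𝓘(ℂ, Cn d) 𝓘(ℂ, Cn m) ω p) (hproper : IsProperMap p)
    (h : HermitianMetric d ℂ L) (hh : UniformlyWeaklyRCPositive (m := m) p h) (t : Y) :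
    ∃ v : Cn m, ‖v‖ = 1 ∧ ∃ K > 0, ∃ δ > 0, ∀ᶠ y in 𝓝 t, ∀ x, p x = y → ∀ u : Cn d,
      0 ≤ defectForm v K δ (fun u => coordCurvature h x u u)
        ((tangentCoordChange 𝓘(ℂ, Cn m) (p x) t (p x)).comp (coordDeriv p x)) u := by
  obtain ⟨hfib, hlift⟩ := hh
  obtain ⟨v₀, hv₀, hlift⟩ := hlift t
  change Cn m at v₀
  have hv₀' : (‖v₀‖ : ℂ) ≠ 0 := by
    simpa using (show v₀ ≠ 0 from hv₀)
  set v : Cn m := (‖v₀‖ : ℂ)⁻¹ • v₀ with hv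
  have hv1 : ‖v‖ = 1 := by
    rw [hv, norm_smul, norm_inv, norm_real, norm_norm, inv_mul_cancel₀]
    simpa using hv₀'
  refine ⟨v, hv1, ?_⟩
  have hlift' : ∀ x, p x = t → ∀ u : Cn d, coordDeriv (m := m) p x u = v →
      0 < (coordCurvature h x u u).re := by
    intro x hx u hu
    have h1 : coordDeriv p x ((‖v₀‖ : ℂ) • u) = v₀ := by
      rw [map_smul, hu, hv, smul_smul, mul_inv_cancel₀ hv₀', one_smul]
    have h2 : 0 < (coordCurvature h x ((‖v₀‖ : ℂ) • u) ((‖v₀‖ : ℂ) • u)).re :=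
      hlift x _ (tangentMap_eq_of_coordDeriv_eq hx h1)
    rw [LinearMap.map_smul, LinearMap.smul_apply, LinearMap.map_smulₛₗ, smul_eq_mul, smul_eq_mul,
      ← mul_assoc, Complex.mul_conj, re_ofReal_mul] at h2
    exact (pos_iff_pos_of_mul_pos h2).1 (normSq_pos.2 hv₀')
  have hcompact : IsCompact (p ⁻¹' {t}) := hproper.isCompact_preimage isCompact_singleton
  let E : ℝ → ℝ → X → Prop := fun K δ x => ∀ u : Cn d,
    0 ≤ defectForm v K δ (fun u => coordCurvature h x u u)
      ((tangentCoordChange 𝓘(ℂ, Cn m) (p x) t (p x)).comp (coordDeriv p x)) u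
  have key : ∃ K > 0, ∃ δ > 0, ∀ᶠ x in 𝓝ˢ (p ⁻¹' {t}), E K δ x := by
    refine hcompact.induction_on (p := fun S => ∃ K > 0, ∃ δ > 0, ∀ᶠ x in 𝓝ˢ S, E K δ x)
      ⟨1, one_pos, 1, one_pos, by simp⟩ ?_ ?_ ?_
    · rintro S S' hS ⟨K, hK, δ, hδ, hE⟩
      exact ⟨K, hK, δ, hδ, hE.filter_mono (nhdsSet_mono hS)⟩
    · rintro S S' ⟨K, hK, δ, hδ, hE⟩ ⟨K', hK', δ', hδ', hE'⟩
      refine ⟨max K K', lt_max_of_lt_left hK, min δ δ', lt_min hδ hδ', ?_⟩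
      rw [nhdsSet_union]
      refine eventually_sup.2 ⟨hE.mono fun x hx u => (hx u).trans ?_,
        hE'.mono fun x hx u => (hx u).trans ?_⟩
      · exact defectForm_mono v (le_max_left _ _) (min_le_left _ _) _ _ u
      · exact defectForm_mono v (le_max_right _ _) (min_le_right _ _) _ _ u
    · intro x₀ hx₀
      obtain ⟨K, hK, δ, hδ, hE⟩ := eventually_estimate hp h x₀ (hfib x₀) (hlift' x₀ hx₀)
      rw [show p x₀ = t from hx₀] at hE
      obtain ⟨V, hVE, hVo, hxV⟩ := eventually_nhds_iff.1 hE
      exact ⟨V, mem_nhdsWithin_of_mem_nhds (hVo.mem_nhds hxV), K, hK, δ, hδ,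
        Filter.mem_of_superset hVo.mem_nhdsSet_self fun x hx => hVE x hx⟩
  obtain ⟨K, hK, δ, hδ, hE⟩ := key
  refine ⟨K, hK, δ, hδ, ?_⟩
  exact hproper.isClosedMap.eventually_nhds_fiber t fun x hx => mem_nhdsSet_iff_forall.1 hE x hx

open Matrix in
theorem trace_mul_mul_vecMulVec_mul (C T : Matrix (Fin m) (Fin m) ℂ) (w : Fin m → ℂ) :
    (C * (T * vecMulVec w (star w) * Tᴴ)).trace = star (T *ᵥ w) ⬝ᵥ C *ᵥ (T *ᵥ w) := by
  rw [mul_vecMulVec, vecMulVec_mul, ← star_mulVec, mul_vecMulVec, trace_vecMulVec, dotProduct_comm]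

open Matrix in
theorem sum_vecMulVec_single : ∑ k : Fin m, vecMulVec (Pi.single k (1 : ℂ)) (star (Pi.single k 1)) =
    (1 : Matrix (Fin m) (Fin m) ℂ) := by
  ext i j
  simp [Matrix.sum_apply, vecMulVec_apply, Pi.single_apply, Matrix.one_apply, apply_ite, eq_comm]

/-- The matrix of the coordinate change of the tangent space at `y` from the chart at `t` to the
preferred chart at `y`. -/
def frameMatrix [IsManifold 𝓘(ℂ, Cn m) ω Y] (t y : Y) : Matrix (Fin m) (Fin m) ℂ :=
  linMatrix (tangentCoordChange 𝓘(ℂ, Cn m) t y y : Cn m →L[ℂ] Cn m).toLinearMap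

open Matrix in
open scoped ComplexOrder in
theorem posDef_vecMulVec_add_smul_one {ε : ℝ} (hε : 0 < ε) (v : Fin m → ℂ) :
    (vecMulVec v (star v) + (ε : ℂ) • (1 : Matrix (Fin m) (Fin m) ℂ)).PosDef := by
  have hε' : (0 : ℂ) < ε := Complex.zero_lt_real.2 hε
  have h1 : (1 : Matrix (Fin m) (Fin m) ℂ).PosDef := PosDef.one
  exact PosDef.posSemidef_add (posSemidef_vecMulVec_self_star v) (h1.smul hε')

open Matrix in
open scoped ComplexOrder in
/-- Near `t` there is a dual metric `v v^* + ε`, constant in the chart at `t`, for which the trace of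
every Schur complement of the curvature is positive. -/
theorem exists_local_dualMetric [IsManifold 𝓘(ℂ, Cn d) ω X] [IsManifold 𝓘(ℂ, Cn m) ω Y]
    [ContMDiffVectorBundle ω ℂ L 𝓘(ℂ, Cn d)] {p : X → Y}
    (hp : ContMDiff 𝓘(ℂ, Cn d) 𝓘(ℂ, Cn m) ω p) (hproper : IsProperMap p)
    (h : HermitianMetric d ℂ L) (hh : UniformlyWeaklyRCPositive (m := m) p h) (t : Y) :
    ∃ B : Matrix (Fin m) (Fin m) ℂ, B.PosDef ∧ ∀ᶠ y in 𝓝 t, ∀ x, p x = y →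
      ∀ C : Matrix (Fin m) (Fin m) ℂ,
      (∀ w, ∃ u, (coordDeriv p x u).ofLp = w ∧ coordCurvature h x u u = star w ⬝ᵥ C *ᵥ w) →
      0 < (C * (frameMatrix t y * B * (frameMatrix t y)ᴴ)).trace.re := by
  obtain ⟨v, hv, K, hK, δ, hδ, hE⟩ := eventually_fiber_estimate hp hproper h hh t
  let e : Fin m → Cn m := fun k => WithLp.toLp 2 (Pi.single k 1)
  obtain ⟨b, hbdef⟩ : ∃ b : ℝ, b = ∑ k, K * ‖e k - ⟪v, e k⟫_ℂ • v‖ ^ 2 := ⟨_, rfl⟩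
  have hb : 0 ≤ b := hbdef ▸ Finset.sum_nonneg fun k _ => by positivity
  obtain ⟨ε, hε, h3⟩ : ∃ ε : ℝ, 0 < ε ∧ ε * b < δ := by
    refine ⟨δ / (b + 1), by positivity, ?_⟩
    rw [div_mul_eq_mul_div, div_lt_iff₀ (by positivity)]
    linarith
  refine ⟨_, posDef_vecMulVec_add_smul_one hε v.ofLp, ?_⟩
  filter_upwards [hE, (chartAt (Cn m) t).open_source.mem_nhds (mem_chart_source _ t)]
    with y hy hyt x hx C hC
  subst hx
  set T := frameMatrix (m := m) t (p x) with hT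
  have hQ : ∀ w : Cn m, δ * ‖⟪v, w⟫_ℂ‖ ^ 2 - K * ‖w - ⟪v, w⟫_ℂ • v‖ ^ 2 ≤
      (star (T *ᵥ w.ofLp) ⬝ᵥ C *ᵥ (T *ᵥ w.ofLp)).re := by
    intro w
    obtain ⟨u, hu, hq⟩ := hC (T *ᵥ w.ofLp)
    rw [hT, frameMatrix, linMatrix_mulVec] at hu
    have hAu : (tangentCoordChange 𝓘(ℂ, Cn m) (p x) t (p x)).comp (coordDeriv p x) u = w := by
      rw [ContinuousLinearMap.comp_apply, WithLp.ofLp_injective 2 hu]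
      refine (tangentCoordChange_comp (I := 𝓘(ℂ, Cn m)) (w := t) (x := p x) (y := t) (z := p x)
        (v := w) (by simpa using hyt)).trans (tangentCoordChange_self (by simpa using hyt))
    have h1 := hy x rfl u
    simp only [defectForm, hAu, hq] at h1
    linarith
  have hv' : ⟪v, v⟫_ℂ = 1 := by rw [inner_self_eq_norm_sq_to_K, hv]; simp
  have hQv := hQ v
  rw [hv', one_smul, sub_self, norm_zero, norm_one] at hQv
  have hQe : -b ≤ ∑ k, (star (T *ᵥ (e k).ofLp) ⬝ᵥ C *ᵥ (T *ᵥ (e k).ofLp)).re := by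
    rw [hbdef, ← Finset.sum_neg_distrib]
    refine Finset.sum_le_sum fun k _ => ?_
    have := hQ (e k)
    have h2 : 0 ≤ δ * ‖⟪v, e k⟫_ℂ‖ ^ 2 := by positivity
    linarith
  have htr : (C * (T * (vecMulVec v.ofLp (star v.ofLp) + (ε : ℂ) • 1) * Tᴴ)).trace.re =
      (star (T *ᵥ v.ofLp) ⬝ᵥ C *ᵥ (T *ᵥ v.ofLp)).re +
        ε * ∑ k, (star (T *ᵥ (e k).ofLp) ⬝ᵥ C *ᵥ (T *ᵥ (e k).ofLp)).re := by
    rw [← sum_vecMulVec_single]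
    simp only [Matrix.mul_add, Matrix.add_mul, Matrix.mul_smul, Matrix.smul_mul, trace_add,
      trace_smul, Matrix.mul_sum, Matrix.sum_mul, trace_sum, trace_mul_mul_vecMulVec_mul, add_re,
      smul_eq_mul, re_ofReal_mul, re_sum]
    rfl
  rw [htr]
  have h5 := mul_le_mul_of_nonneg_left hQe hε.le
  linarith

end FibreEstimate

/-! ### Smoothness of matrix inverses -/

section MatrixSmooth

open Matrix

variable {m : ℕ} {n : WithTop ℕ∞}

theorem contDiff_matrix_det : ContDiff ℝ n fun M : Fin m → Fin m → ℂ => (Matrix.of M).det := by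
  simp only [Matrix.det_apply, Matrix.of_apply]
  refine ContDiff.sum fun σ _ => ContDiff.const_smul _ (contDiff_prod fun i _ => ?_)
  fun_prop

theorem contDiff_matrix_adjugate (i j : Fin m) :
    ContDiff ℝ n fun M : Fin m → Fin m → ℂ => (Matrix.of M).adjugate i j := by
  simp only [Matrix.adjugate_apply]
  refine contDiff_matrix_det.comp (f := fun M : Fin m → Fin m → ℂ =>
    Function.update M j (Pi.single i 1)) ?_
  refine contDiff_pi.2 fun k => ?_
  by_cases hk : k = j
  · subst hk
    simp only [Function.update_self]
    exact contDiff_const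
  · simp only [Function.update_of_ne hk]
    fun_prop

theorem contDiffAt_matrix_inv (i j : Fin m) {M : Fin m → Fin m → ℂ} (hM : (Matrix.of M).det ≠ 0) :
    ContDiffAt ℝ n (fun M : Fin m → Fin m → ℂ => (Matrix.of M)⁻¹ i j) M := by
  simp only [Matrix.inv_def, Ring.inverse_eq_inv', Matrix.smul_apply]
  exact (contDiff_matrix_det.contDiffAt.inv hM).smul (contDiff_matrix_adjugate i j).contDiffAt

open scoped ComplexOrder in
theorem convex_posDef : Convex ℝ {M : Matrix (Fin m) (Fin m) ℂ | M.PosDef} := by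
  intro A hA B hB a b ha hb hab
  have hA' : Matrix.PosDef A := hA
  have hB' : Matrix.PosDef B := hB
  rcases ha.eq_or_lt with rfl | ha
  · rw [zero_add] at hab
    simpa [hab] using hB
  · exact (hA'.smul ha).add_posSemidef (hB'.posSemidef.smul hb)

theorem convex_trace_mul_pos (C : Matrix (Fin m) (Fin m) ℂ) :
    Convex ℝ {M : Matrix (Fin m) (Fin m) ℂ | 0 < (C * M).trace.re} := by
  have h : IsLinearMap ℝ fun M : Matrix (Fin m) (Fin m) ℂ => (C * M).trace.re :=
    ⟨fun M N => by simp [Matrix.mul_add], fun c M => by simp⟩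
  exact convex_halfSpace_gt h 0

end MatrixSmooth

/-! ### Gluing dual metrics -/

section Gluing

open scoped Topology ComplexOrder
open Filter Matrix

variable {m : ℕ}

/-- The sesquilinear form `(u, v) ↦ v^* M u`. -/
def matrixSesq (M : Matrix (Fin m) (Fin m) ℂ) : Sesq (Cn m) :=
  LinearMap.mk₂'ₛₗ (RingHom.id ℂ) (starRingEnd ℂ) (fun u v => star v.ofLp ⬝ᵥ M *ᵥ u.ofLp)
    (by intro u u' v; simp [mulVec_add])
    (by intro c u v; simp [mulVec_smul])
    (by intro u v v'; simp)
    (by intro c u v; simp)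

theorem matrixSesq_apply (M : Matrix (Fin m) (Fin m) ℂ) (u v : Cn m) :
    matrixSesq M u v = star v.ofLp ⬝ᵥ M *ᵥ u.ofLp := rfl

theorem finite_support_partition {Y : Type*} [TopologicalSpace Y] [ChartedSpace (Cn m) Y]
    (ρ : SmoothPartitionOfUnity Y 𝓘(ℝ, Cn m) Y)
    (M : Y → Matrix (Fin m) (Fin m) ℂ) (y : Y) :
    (Function.support fun t => ρ t y • M t).Finite :=
  (ρ.locallyFinite.point_finite y).subset fun t ht h0 => ht (by simp [show ρ t y = 0 from h0])

variable {Y : Type*} [TopologicalSpace Y] [ChartedSpace (Cn m) Y] [IsManifold 𝓘(ℂ, Cn m) ω Y]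

/-- The dual metric `∑ ρ_t B_t` obtained by gluing the dual metrics `B_t`, constant in the chart at
`t`, with weights `ρ_t`. -/
def gluedDualMetric (ρ : Y → Y → ℝ) (B : Y → Matrix (Fin m) (Fin m) ℂ) (y : Y) :
    Matrix (Fin m) (Fin m) ℂ :=
  ∑ᶠ t, ρ t y • (frameMatrix t y * B t * (frameMatrix t y)ᴴ)

/-- The inverse at `y` of a trivialization of the tangent bundle, with the tangent space identified
to the model space by the preferred chart. -/
def symmCLM (e : Trivialization (Cn m) (π (Cn m) (TangentSpace 𝓘(ℂ, Cn m) : Y → Type _)))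
    [MemTrivializationAtlas e] (y : Y) : Cn m →L[ℂ] Cn m :=
  e.symmL ℂ y

/-- A trivialization of the tangent bundle at `y`, with the tangent space identified to the model
space by the preferred chart. -/
def trivCLM (e : Trivialization (Cn m) (π (Cn m) (TangentSpace 𝓘(ℂ, Cn m) : Y → Type _)))
    [MemTrivializationAtlas e] (y : Y) : Cn m →L[ℂ] Cn m :=
  e.continuousLinearMapAt ℂ y

/-- The matrix of `symmCLM`. -/
def symmMatrix (e : Trivialization (Cn m) (π (Cn m) (TangentSpace 𝓘(ℂ, Cn m) : Y → Type _)))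
    [MemTrivializationAtlas e] (y : Y) : Matrix (Fin m) (Fin m) ℂ :=
  linMatrix (symmCLM e y).toLinearMap

/-- The matrix of `trivCLM`. -/
def trivMatrix (e : Trivialization (Cn m) (π (Cn m) (TangentSpace 𝓘(ℂ, Cn m) : Y → Type _)))
    [MemTrivializationAtlas e] (y : Y) : Matrix (Fin m) (Fin m) ℂ :=
  linMatrix (trivCLM e y).toLinearMap

/-- The matrix at `y` of the coordinate change from the trivialization at `t` to `e`. -/
def transitionMatrix (t : Y)
    (e : Trivialization (Cn m) (π (Cn m) (TangentSpace 𝓘(ℂ, Cn m) : Y → Type _)))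
    [MemTrivializationAtlas e] (y : Y) : Matrix (Fin m) (Fin m) ℂ :=
  linMatrix (Trivialization.coordChangeL ℂ
    (trivializationAt (Cn m) (TangentSpace 𝓘(ℂ, Cn m) : Y → Type _) t) e y :
      Cn m →L[ℂ] Cn m).toLinearMap

theorem linMatrix_eq_one {A : Cn m →ₗ[ℂ] Cn m} (h : ∀ u, A u = u) : linMatrix A = 1 := by
  ext i j
  simp [linMatrix, h, stdVec, Matrix.one_apply]

section Matrices

variable (e : Trivialization (Cn m) (π (Cn m) (TangentSpace 𝓘(ℂ, Cn m) : Y → Type _)))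
  [MemTrivializationAtlas e] {y : Y}

theorem trivMatrix_mul_symmMatrix (hy : y ∈ e.baseSet) : trivMatrix e y * symmMatrix e y = 1 := by
  rw [trivMatrix, symmMatrix, ← linMatrix_comp]
  exact linMatrix_eq_one fun u => e.continuousLinearMapAt_symmL (R := ℂ) hy u

theorem frameMatrix_eq_symmMatrix {t : Y} (hyt : y ∈ (chartAt (Cn m) t).source) :
    frameMatrix t y =
      symmMatrix (trivializationAt (Cn m) (TangentSpace 𝓘(ℂ, Cn m) : Y → Type _) t) y := by
  rw [symmMatrix, symmCLM, frameMatrix, TangentBundle.symmL_trivializationAt_eq_core hyt]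

theorem trivMatrix_mul_frameMatrix {t : Y} (hyt : y ∈ (chartAt (Cn m) t).source)
    (hy : y ∈ e.baseSet) : trivMatrix e y * frameMatrix t y = transitionMatrix t e y := by
  rw [frameMatrix_eq_symmMatrix hyt, trivMatrix, symmMatrix, transitionMatrix, ← linMatrix_comp]
  congr 1
  ext1 u
  have h1 := Trivialization.coordChangeL_apply (R := ℂ)
    (trivializationAt (Cn m) (TangentSpace 𝓘(ℂ, Cn m) : Y → Type _) t) e ⟨hyt, hy⟩ u
  refine Eq.trans ?_ h1.symm
  rw [← Trivialization.continuousLinearMapAt_apply_of_mem ℂ e hy,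
    ← Trivialization.symmL_apply (R := ℂ) _ hyt]
  rfl

theorem contMDiffAt_transitionMatrix {t : Y} (hyt : y ∈ (chartAt (Cn m) t).source)
    (hy : y ∈ e.baseSet) (i j : Fin m) :
    ContMDiffAt 𝓘(ℝ, Cn m) 𝓘(ℝ, ℂ) ∞ (fun y => transitionMatrix t e y i j) y := by
  have h1 := (contMDiffOn_coordChangeL (n := ∞) (IB := 𝓘(ℂ, Cn m))
    (trivializationAt (Cn m) (TangentSpace 𝓘(ℂ, Cn m) : Y → Type _) t) e).contMDiffAt
    (((Trivialization.open_baseSet _).inter e.open_baseSet).mem_nhds ⟨hyt, hy⟩)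
  let ℓ : (Cn m →L[ℂ] Cn m) →L[ℂ] ℂ :=
    (EuclideanSpace.proj i : Cn m →L[ℂ] ℂ).comp (ContinuousLinearMap.apply ℂ (Cn m) (stdVec j))
  exact (ℓ.contMDiff.contMDiffAt.comp y h1).restrictScalars_real

end Matrices

/-- In a trivialization `e` of the tangent bundle the glued dual metric is a sum with smooth
coefficients. -/
theorem trivMatrix_mul_gluedDualMetric (ρ : SmoothPartitionOfUnity Y 𝓘(ℝ, Cn m) Y)
    (B : Y → Matrix (Fin m) (Fin m) ℂ)
    (hρ : ∀ t, tsupport (ρ t) ⊆ (chartAt (Cn m) t).source)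
    (e : Trivialization (Cn m) (π (Cn m) (TangentSpace 𝓘(ℂ, Cn m) : Y → Type _)))
    [MemTrivializationAtlas e] {y : Y} (hy : y ∈ e.baseSet) :
    trivMatrix e y * gluedDualMetric (fun t => ρ t) B y * (trivMatrix e y)ᴴ =
      ∑ᶠ t, ρ t y • (transitionMatrix t e y * B t * (transitionMatrix t e y)ᴴ) := by
  let Φ : Matrix (Fin m) (Fin m) ℂ →+ Matrix (Fin m) (Fin m) ℂ :=
    { toFun := fun M => trivMatrix e y * M * (trivMatrix e y)ᴴ
      map_zero' := by simp
      map_add' := fun M N => by rw [Matrix.mul_add, Matrix.add_mul] }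
  change Φ (gluedDualMetric (fun t => ρ t) B y) = _
  rw [gluedDualMetric, Φ.map_finsum (finite_support_partition ρ _ y)]
  refine finsum_congr fun t => ?_
  by_cases ht : ρ t y = 0
  · simp [ht]
  · have hyt := hρ t (subset_tsupport _ ht)
    rw [← trivMatrix_mul_frameMatrix e hyt hy]
    simp only [Φ, AddMonoidHom.coe_mk, ZeroHom.coe_mk, conjTranspose_mul, Matrix.mul_smul,
      Matrix.smul_mul, Matrix.mul_assoc]

theorem contMDiffAt_glued_entry (ρ : SmoothPartitionOfUnity Y 𝓘(ℝ, Cn m) Y)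
    (B : Y → Matrix (Fin m) (Fin m) ℂ)
    (hρ : ∀ t, tsupport (ρ t) ⊆ (chartAt (Cn m) t).source)
    (e : Trivialization (Cn m) (π (Cn m) (TangentSpace 𝓘(ℂ, Cn m) : Y → Type _)))
    [MemTrivializationAtlas e] {y : Y} (hy : y ∈ e.baseSet) :
    ContMDiffAt 𝓘(ℝ, Cn m) 𝓘(ℝ, Fin m → Fin m → ℂ) ∞ (fun y i j =>
      (∑ᶠ t, ρ t y • (transitionMatrix t e y * B t * (transitionMatrix t e y)ᴴ)) i j) y := by
  refine contMDiffAt_pi_space.2 fun i => contMDiffAt_pi_space.2 fun j => ?_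
  let Φ : Matrix (Fin m) (Fin m) ℂ →+ ℂ := Matrix.entryAddMonoidHom ℂ i j
  have h1 : ∀ y, (∑ᶠ t, ρ t y • (transitionMatrix t e y * B t * (transitionMatrix t e y)ᴴ)) i j =
      ∑ᶠ t, ρ t y • (transitionMatrix t e y * B t * (transitionMatrix t e y)ᴴ) i j := fun y =>
    Φ.map_finsum (finite_support_partition ρ _ y)
  simp only [h1]
  refine ρ.contMDiffAt_finsum (n := ⊤) fun t ht => ?_
  have hP := fun i j => contMDiffAt_transitionMatrix e (hρ t ht) hy i j
  have hP' : ContMDiffAt 𝓘(ℝ, Cn m) 𝓘(ℝ, Fin m → Fin m → ℂ) ∞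
      (fun y i j => transitionMatrix t e y i j) y :=
    contMDiffAt_pi_space.2 fun i => contMDiffAt_pi_space.2 fun j => hP i j
  have hpoly : ContDiff ℝ ∞ fun P : Fin m → Fin m → ℂ =>
      ∑ k, (∑ l, P i l * B t l k) * (starRingEnd ℂ) (P j k) := by
    refine ContDiff.sum fun k _ => ContDiff.mul (ContDiff.sum fun l _ => ?_) ?_
    · exact ContDiff.mul (by fun_prop) contDiff_const
    · exact conjCLE.contDiff.comp (by fun_prop)
  exact (hpoly.contMDiff.contMDiffAt.comp y hP')

theorem posDef_gluedDualMetric (ρ : SmoothPartitionOfUnity Y 𝓘(ℝ, Cn m) Y)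
    {B : Y → Matrix (Fin m) (Fin m) ℂ} (hB : ∀ t, (B t).PosDef)
    (hρ : ∀ t, tsupport (ρ t) ⊆ (chartAt (Cn m) t).source) (y : Y) :
    (gluedDualMetric (fun t => ρ t) B y).PosDef :=
  convex_posDef.finsum_mem (fun t => ρ.nonneg t y) (ρ.sum_eq_one (Set.mem_univ y)) fun t ht => by
    have hyt := hρ t (subset_tsupport _ ht)
    have h1 := trivMatrix_mul_symmMatrix
      (trivializationAt (Cn m) (TangentSpace 𝓘(ℂ, Cn m) : Y → Type _) t) hyt
    rw [← frameMatrix_eq_symmMatrix hyt] at h1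
    exact (hB t).mul_mul_conjTranspose_same (Matrix.vecMul_injective_of_isUnit
      ((Matrix.isUnit_iff_isUnit_det _).2 (Matrix.isUnit_det_of_left_inverse h1)))

/-- The metric on the tangent bundle whose dual metric is the glued one. -/
def gluedMetric (ρ : SmoothPartitionOfUnity Y 𝓘(ℝ, Cn m) Y)
    (B : Y → Matrix (Fin m) (Fin m) ℂ)
    (hρ : ∀ t, tsupport (ρ t) ⊆ (chartAt (Cn m) t).source)
    (hpos : ∀ y, (gluedDualMetric (fun t => ρ t) B y).PosDef) :
    HermitianMetric m (Cn m) (TangentSpace 𝓘(ℂ, Cn m) : Y → Type _) where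
  form y := matrixSesq (gluedDualMetric (fun t => ρ t) B y)⁻¹
  conj_symm y u v := by
    have h := (hpos y).inv.isHermitian
    change star (v : Cn m).ofLp ⬝ᵥ _ *ᵥ (u : Cn m).ofLp =
      star (star (u : Cn m).ofLp ⬝ᵥ _ *ᵥ (v : Cn m).ofLp)
    rw [star_dotProduct, star_mulVec, h.eq, ← dotProduct_mulVec]
  pos y u hu := by
    have hu' : (u : Cn m).ofLp ≠ 0 := fun h0 => hu (WithLp.ofLp_injective 2 h0)
    exact (Complex.lt_def.1 ((hpos y).inv.dotProduct_mulVec_pos hu')).1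
  smooth e _ f g := by
    intro y hy
    refine ContMDiffAt.contMDiffWithinAt ?_
    let N : Y → Fin m → Fin m → ℂ := fun y i j =>
      (∑ᶠ t, ρ t y • (transitionMatrix t e y * B t * (transitionMatrix t e y)ᴴ)) i j
    have hN : ContMDiffAt 𝓘(ℝ, Cn m) 𝓘(ℝ, Fin m → Fin m → ℂ) ∞ N y :=
      contMDiffAt_glued_entry ρ B hρ e hy
    have hNG : ∀ y ∈ e.baseSet, Matrix.of (N y) =
        trivMatrix e y * gluedDualMetric (fun t => ρ t) B y * (trivMatrix e y)ᴴ := fun y hy =>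
      (trivMatrix_mul_gluedDualMetric ρ B hρ e hy).symm
    have hdet : (Matrix.of (N y)).det ≠ 0 := by
      have h1 := congrArg det (trivMatrix_mul_symmMatrix e hy)
      rw [det_mul, det_one] at h1
      rw [hNG y hy, det_mul, det_mul, det_conjTranspose]
      have h2 : (trivMatrix e y).det ≠ 0 := left_ne_zero_of_mul_eq_one h1
      exact mul_ne_zero (mul_ne_zero h2 (hpos y).det_pos.ne') (star_ne_zero.2 h2)
    have hsmooth : ContMDiffAt 𝓘(ℝ, Cn m) 𝓘(ℝ, ℂ) ∞
        (fun y => ∑ i, star (g i) * ∑ j, (Matrix.of (N y))⁻¹ i j * f j) y := by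
      have h1 : ContDiffAt ℝ ∞ (fun M : Fin m → Fin m → ℂ =>
          ∑ i, star (g i) * ∑ j, (Matrix.of M)⁻¹ i j * f j) (N y) :=
        ContDiffAt.sum fun i _ => contDiffAt_const.mul
          (ContDiffAt.sum fun j _ => (contDiffAt_matrix_inv i j hdet).mul contDiffAt_const)
      exact h1.contMDiffAt.comp y hN
    refine hsmooth.congr_of_eventuallyEq ?_
    filter_upwards [e.open_baseSet.mem_nhds hy] with y hy
    have hDE := trivMatrix_mul_symmMatrix e hy
    have hinv : (Matrix.of (N y))⁻¹ =
        (symmMatrix e y)ᴴ * (gluedDualMetric (fun t => ρ t) B y)⁻¹ * symmMatrix e y := by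
      rw [hNG y hy]
      simp only [Matrix.mul_inv_rev, Matrix.inv_eq_right_inv hDE, ← conjTranspose_nonsing_inv,
        Matrix.mul_assoc]
    have hs : ∀ f : Cn m, symmMatrix e y *ᵥ f.ofLp = (symmCLM e y f).ofLp := fun f =>
      linMatrix_mulVec _ f
    have hform : matrixSesq (gluedDualMetric (fun t => ρ t) B y)⁻¹ (symmCLM e y f)
        (symmCLM e y g) = star g.ofLp ⬝ᵥ (Matrix.of (N y))⁻¹ *ᵥ f.ofLp := by
      rw [matrixSesq_apply, ← hs f, ← hs g, hinv, star_mulVec, ← dotProduct_mulVec,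
        Matrix.mulVec_mulVec, Matrix.mulVec_mulVec]
    have hf : ∀ f : Cn m, symmCLM e y f = (e.symm y f : TangentSpace 𝓘(ℂ, Cn m) y) :=
      fun f => e.symmL_apply (R := ℂ) hy f
    rw [hf f, hf g] at hform
    exact hform

end Gluing

end

/-! ### The metric on the base -/

theorem coordCurvature_conj_symm {d : ℕ} {X : Type*} [TopologicalSpace X] [ChartedSpace (Cn d) X]
    [IsManifold 𝓘(ℂ, Cn d) ω X]
    {L : X → Type*} [TopologicalSpace (TotalSpace ℂ L)] [∀ x, TopologicalSpace (L x)]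
    [∀ x, AddCommGroup (L x)] [∀ x, Module ℂ (L x)] [FiberBundle ℂ L] [VectorBundle ℂ ℂ L]
    (h : HermitianMetric d ℂ L) (x : X) (u v : Cn d) :
    coordCurvature h x u v = (starRingEnd ℂ) (coordCurvature h x v u) := by
  have h1 : ContDiffAt ℝ ∞ (localWeight h x) (chartAt (Cn d) x x) :=
    contDiffAt_localWeight h (mem_chart_source _ x) (mem_baseSet_trivializationAt ℂ L x)
  have hsymm : IsSymmSndFDerivAt ℝ (localWeight h x) (chartAt (Cn d) x x) :=
    h1.isSymmSndFDerivAt (by simp only [minSmoothness_of_isRCLikeNormedField]; norm_cast)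
  change leviFun _ _ u v = (starRingEnd ℂ) (leviFun _ _ v u)
  simp only [leviFun, hsymm.eq v u, hsymm.eq (I • v) (I • u), hsymm.eq v (I • u),
    hsymm.eq (I • v) u]
  simp only [map_div₀, map_add, map_mul, conj_ofReal, conj_I, map_ofNat]
  push_cast
  ring

theorem mainTheorem7 {n m : ℕ}
    {X : Type*} [TopologicalSpace X] [T2Space X] [SecondCountableTopology X]
    [ChartedSpace (Cn (n + m)) X] [IsManifold 𝓘(ℂ, Cn (n + m)) ω X]
    {Y : Type*} [TopologicalSpace Y] [T2Space Y] [SecondCountableTopology Y]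
    [ChartedSpace (Cn m) Y] [IsManifold 𝓘(ℂ, Cn m) ω Y]
    (p : X → Y) (hp : ContMDiff 𝓘(ℂ, Cn (n + m)) 𝓘(ℂ, Cn m) ω p) (hproper : IsProperMap p)
    (hsubm : ∀ x : X, Function.Surjective (mfderiv 𝓘(ℂ, Cn (n + m)) 𝓘(ℂ, Cn m) p x))
    {L : X → Type*} [TopologicalSpace (TotalSpace ℂ L)] [∀ x, TopologicalSpace (L x)]
    [∀ x, AddCommGroup (L x)] [∀ x, Module ℂ (L x)] [FiberBundle ℂ L] [VectorBundle ℂ ℂ L]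
    [ContMDiffVectorBundle ω ℂ L 𝓘(ℂ, Cn (n + m))]
    (h : HermitianMetric (n + m) ℂ L) (hh : UniformlyWeaklyRCPositive (m := m) p h) :
    ∃ α : HermitianMetric m (Cn m) (TangentSpace 𝓘(ℂ, Cn m) : Y → Type _),
      ∀ x : X, IsPositiveTop
        (curvatureForm h x ^ (n + 1) * pullbackAt (m := m) p x (metricForm α (p x) ^ (m - 1))) := by
  classical
  have := isManifold_real (X := Y) (d := m)
  have : LocallyCompactSpace Y := Manifold.locallyCompact_of_finiteDimensional 𝓘(ℝ, Cn m)
  choose B hB hBpos using exists_local_dualMetric hp hproper h hh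
  -- the open sets on which the local dual metrics have positive trace
  let U : Y → Set Y := fun t => interior {y | ∀ x, p x = y → ∀ C : Matrix (Fin m) (Fin m) ℂ,
      (∀ w, ∃ u, (coordDeriv p x u).ofLp = w ∧
        coordCurvature h x u u = dotProduct (star w) (C.mulVec w)) →
      0 < (C * (frameMatrix t y * B t * (frameMatrix t y).conjTranspose)).trace.re} ∩
    (chartAt (Cn m) t).source
  have hU : ∀ t, IsOpen (U t) := fun t => isOpen_interior.inter (chartAt (Cn m) t).open_source
  have hmem : ∀ t, t ∈ U t := fun t =>
    ⟨mem_interior_iff_mem_nhds.2 (hBpos t), mem_chart_source _ t⟩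
  obtain ⟨ρ, hρ⟩ := SmoothPartitionOfUnity.exists_isSubordinate 𝓘(ℝ, Cn m) isClosed_univ U hU
    fun t _ => Set.mem_iUnion.2 ⟨t, hmem t⟩
  have hρU : ∀ t y, ρ t y ≠ 0 → y ∈ U t := fun t y hy => hρ t (subset_tsupport _ hy)
  have hsum : ∀ y, ∑ᶠ t, ρ t y = 1 := fun y => ρ.sum_eq_one (Set.mem_univ y)
  have hρchart : ∀ t, tsupport (ρ t) ⊆ (chartAt (Cn m) t).source := fun t =>
    (hρ t).trans Set.inter_subset_right
  have hpos := posDef_gluedDualMetric ρ hB hρchart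
  refine ⟨gluedMetric ρ B hρchart hpos, fun x => ?_⟩
  obtain ⟨C, hC, hCpos⟩ := exists_schurComplement (H := coordCurvature h x)
    (coordCurvature_conj_symm h x) (A := (coordDeriv (m := m) p x).toLinearMap) (hsubm x)
    (fun u hu hu0 => hh.1 x u hu hu0)
  refine hCpos (matrixSesq (gluedDualMetric (fun t => ρ t) B (p x))⁻¹) _ (hpos (p x))
    (fun u v => rfl) ?_
  -- the trace condition is convex in the dual metric
  exact (convex_trace_mul_pos C).finsum_mem (fun t => ρ.nonneg t (p x)) (hsum (p x)) fun t ht =>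
    interior_subset (hρU t (p x) ht).1 x rfl C hC
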